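/- Let $G$ be a compact connected Lie group with Lie algebra $\mathfrak g$, acting by a (smooth) orthogonal representation on a finite-dimensional real inner product space $V$, and fix an $\mathrm{Ad}_G$-invariant inner product on $\mathfrak g$. For $v\in V$ and $x\in\mathfrak g$ let $x\cdot v$ denote the infinitesimal action. Let $m$ be the maximal dimension of a $G$-orbit; $v$ is regular if $\dim Gv=m$, and a regular orbit $Gv$ is principal if the isotropy group $G_v$ has the least possible number of connected components among isotropy groups of regular points. The discriminant $\delta:V\to\mathbf R$ is defined by $\delta(v)=k^2\,\mathrm{vol}_m(Gv)^2$ if $v$ is regular, where $k=[G_v:H]$ is the index of the covering $G/H\to Gv$ for a principal isotropy group $H\subset G_v$ and $\mathrm{vol}_m$ is the $m$-dimensional volume with respect to the metric induced from $V$, and by $\delta(v)=0$ if $v$ is not regular. Let $\mathbf R[V]_m$ be the space of homogeneous real polynomials of degree $m$ on $V$, with the action $(gf)(v)=f(g^{-1}v)$, and let $$\Phi:\Lambda^m\mathfrak g\otimes\Lambda^mV\to\mathbf R[V]_m,\qquad \Phi(x_1\wedge\cdots\wedge x_m\otimes v_1\wedge\cdots\wedge v_m)(v)=\langle x_1\cdot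 v\wedge\cdots\wedge x_m\cdot v,\;v_1\wedge\cdots\wedge v_m\rangle$$ be the equivariant minor map. The space $\Lambda^m\mathfrak g\otimes\Lambda^mV$ carries the induced inner product and $G$-action. Suppose that $(G,V)$ is polar, i.e. there is a linear subspace $\mathfrak c\subset V$ which meets every $G$-orbit and meets every $G$-orbit orthogonally ($x\cdot u\perp\mathfrak c$ for all $u\in\mathfrak c$, $x\in\mathfrak g$). Then: (a) For every irreducible $G$-invariant subspace $W\subset\Lambda^m\mathfrak g\otimes\Lambda^mV$ with $\Phi(W)\neq0$ there is a constant $c>0$ such that, for every orthonormal basis $\{w_i\}$ of $W$, $\sum_i\Phi(w_i)^2=c\,\delta$ on $V$; consequently $\delta=\sum_i\bigl(c^{-1/2}\Phi(w_i)\bigr)^2$ is a sum of squares of homogeneous polynomials of degree $m$. (b) Every irreducible $G$-invariant subspace $U$ of the image of $\Phi$ has a basis $\{p_i\}$ such that $\delta=\sum_i p_i^2$ on $V$. -/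

import Mathlib

open scoped Manifold ContDiff TensorProduct MeasureTheory

noncomputable section

namespace PolarDisc

/-- The `m`-th exterior power of a linear representation. -/
def extPower {G V : Type*} [Group G] [AddCommGroup V] [Module ℝ V]
    (ρ : Representation ℝ G V) (m : ℕ) : Representation ℝ G (⋀[ℝ]^m V) where
  toFun g := exteriorPower.map m (ρ g)
  map_one' := by
    rw [map_one]
    exact exteriorPower.map_id
  map_mul' g h := by
    rw [map_mul, Module.End.mul_eq_comp, Module.End.mul_eq_comp, exteriorPower.map_comp]

/-- A subrepresentation is irreducible as a representation in its own right: it is nonzero and has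
no subrepresentations other than zero and itself. -/
def IsIrreducibleSub {G V : Type*} [Group G] [AddCommMonoid V] [Module ℝ V]
    {ρ : Representation ℝ G V} (W : Subrepresentation ρ) : Prop :=
  IsSimpleOrder (Subrepresentation W.toRepresentation)

section LieGroup

variable (E G : Type*) [NormedAddCommGroup E] [NormedSpace ℝ E]
  [TopologicalSpace G] [ChartedSpace E G] [Group G]

/-- The Lie algebra of `G`, i.e. the tangent space at the identity. -/
abbrev LieAlg : Type _ := GroupLieAlgebra 𝓘(ℝ, E) G

instance [FiniteDimensional ℝ E] : FiniteDimensional ℝ (LieAlg E G) :=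
  inferInstanceAs (FiniteDimensional ℝ E)

variable {G}

/-- `Ad g`, the differential at the identity of the conjugation `h ↦ g h g⁻¹`
(it takes values in the tangent space at `g 1 g⁻¹ = 1`). -/
def adMap (g : G) : LieAlg E G →ₗ[ℝ] LieAlg E G :=
  (show E →L[ℝ] E from mfderiv 𝓘(ℝ, E) 𝓘(ℝ, E) (fun h : G => g * h * g⁻¹) 1).toLinearMap

variable (G) in
/-- The adjoint representation of `G`. -/
def adRep [LieGroup 𝓘(ℝ, E) ∞ G] : Representation ℝ G (LieAlg E G) where
  toFun := adMap E
  map_one' := by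
    have h : (fun h : G => (1 : G) * h * (1 : G)⁻¹) = id := by
      funext h; simp
    refine LinearMap.ext fun x => ?_
    change (show E →L[ℝ] E from mfderiv 𝓘(ℝ, E) 𝓘(ℝ, E) (fun h : G => 1 * h * 1⁻¹) 1) x = x
    rw [h, mfderiv_id]
    rfl
  map_mul' a b := by
    have hd : ∀ (c y : G),
        MDifferentiableAt 𝓘(ℝ, E) 𝓘(ℝ, E) (fun h : G => c * h * c⁻¹) y := fun c y =>
      ContMDiffAt.mdifferentiableAt (n := ∞)
        (((contMDiff_const.mul contMDiff_id).mul contMDiff_const).contMDiffAt) (by simp)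
    have h : (fun h : G => (a * b) * h * (a * b)⁻¹)
        = (fun h : G => a * h * a⁻¹) ∘ (fun h : G => b * h * b⁻¹) := by
      funext h; simp [mul_assoc]
    have key : ∀ y : G, y = 1 →
        (show E →L[ℝ] E from mfderiv 𝓘(ℝ, E) 𝓘(ℝ, E) (fun h : G => a * h * a⁻¹) y)
          = (show E →L[ℝ] E from mfderiv 𝓘(ℝ, E) 𝓘(ℝ, E) (fun h : G => a * h * a⁻¹) 1) := by
      rintro y rfl; rfl
    refine LinearMap.ext fun x => ?_
    change (show E →L[ℝ] E from
        mfderiv 𝓘(ℝ, E) 𝓘(ℝ, E) (fun h : G => (a * b) * h * (a * b)⁻¹) 1) x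
      = (show E →L[ℝ] E from mfderiv 𝓘(ℝ, E) 𝓘(ℝ, E) (fun h : G => a * h * a⁻¹) 1)
        ((show E →L[ℝ] E from mfderiv 𝓘(ℝ, E) 𝓘(ℝ, E) (fun h : G => b * h * b⁻¹) 1) x)
    rw [h, mfderiv_comp (I' := 𝓘(ℝ, E)) 1 (hd a _) (hd b 1), ← key (b * 1 * b⁻¹) (by simp)]
    rfl

/-- An inner product on the Lie algebra is `Ad G`-invariant. -/
def IsAdInvariant [LieGroup 𝓘(ℝ, E) ∞ G] (B : InnerProductSpace.Core ℝ (LieAlg E G)) : Prop :=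
  ∀ (g : G) (x y : LieAlg E G), B.inner (adRep E G g x) (adRep E G g y) = B.inner x y

end LieGroup

section Poly

variable {V : Type*} [AddCommGroup V] [Module ℝ V]

variable (V) in
/-- The space `ℝ[V]_m` of homogeneous polynomial functions of degree `m` on `V`: the linear span
of the products of `m` linear functionals. -/
def homogPoly (m : ℕ) : Submodule ℝ (V → ℝ) :=
  Submodule.span ℝ (Set.range fun (φ : Fin m → Module.Dual ℝ V) (v : V) => ∏ i, φ i v)

/-- The action `(g f)(v) = f(g⁻¹ v)` on homogeneous polynomial functions. -/
def polyRep {G : Type*} [Group G] (ρ : Representation ℝ G V) (m : ℕ) :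
    Representation ℝ G (homogPoly V m) where
  toFun g := (LinearMap.funLeft ℝ ℝ (ρ g⁻¹)).restrict (p := homogPoly V m) (q := homogPoly V m)
    (by
      suffices h : homogPoly V m ≤ (homogPoly V m).comap (LinearMap.funLeft ℝ ℝ (ρ g⁻¹)) from
        fun f hf => h hf
      refine Submodule.span_le.2 ?_
      rintro _ ⟨φ, rfl⟩
      exact Submodule.subset_span ⟨fun i => (φ i).comp (ρ g⁻¹), rfl⟩)
  map_one' := by
    ext f v
    simp [LinearMap.funLeft]
  map_mul' a b := by
    ext f v
    simp [LinearMap.funLeft]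

end Poly

/-- An orthogonal representation on `V` of a Lie group `G` modelled on `E`. -/
structure OrthogonalRep (E G V : Type*) [NormedAddCommGroup E] [NormedSpace ℝ E]
    [TopologicalSpace G] [ChartedSpace E G] [Group G]
    [NormedAddCommGroup V] [InnerProductSpace ℝ V] where
  toHom : G →* (V ≃ₗᵢ[ℝ] V)
  smooth : ∀ v : V, ContMDiff 𝓘(ℝ, E) 𝓘(ℝ, V) ∞ fun g : G => toHom g v

namespace OrthogonalRep

variable {E G V : Type*} [NormedAddCommGroup E] [NormedSpace ℝ E]
  [TopologicalSpace G] [ChartedSpace E G] [Group G]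
  [NormedAddCommGroup V] [InnerProductSpace ℝ V] (π : OrthogonalRep E G V)

/-- The underlying linear representation. -/
def rep : Representation ℝ G V where
  toFun g := (π.toHom g).toLinearEquiv.toLinearMap
  map_one' := by rw [map_one]; rfl
  map_mul' a b := by rw [map_mul]; rfl

/-- The map `V → Hom(𝔤, V)` encoding the infinitesimal action: `π.infAct v x = x · v` is the
derivative at the identity of `g ↦ g v` in the direction `x`. -/
def infAct : V →ₗ[ℝ] LieAlg E G →ₗ[ℝ] V where
  toFun v := (mvfderiv 𝓘(ℝ, E) (fun g : G => π.toHom g v) 1).toLinearMap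
  map_add' v w := by
    have hd := fun u : V => ((π.smooth u).contMDiffAt (x := (1 : G))).mdifferentiableAt (by simp)
    have h : (fun g : G => π.toHom g (v + w))
        = (fun g : G => π.toHom g v) + fun g : G => π.toHom g w := by
      funext g; simp
    rw [h, mvfderiv_add (hd v) (hd w)]
    rfl
  map_smul' c v := by
    have hd := ((π.smooth v).contMDiffAt (x := (1 : G))).mdifferentiableAt (by simp)
    have h : (fun g : G => π.toHom g (c • v)) = c • fun g : G => π.toHom g v := by
      funext g; simp
    rw [h, mvfderiv, const_smul_mfderiv hd]
    rfl

/-- The orbit `G v`. -/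
def orbit (v : V) : Set V := Set.range fun g : G => π.toHom g v

/-- The isotropy group `G_v`. -/
def isotropy (v : V) : Subgroup G where
  carrier := {g | π.toHom g v = v}
  one_mem' := by simp
  mul_mem' {a b} ha hb := by
    simp only [Set.mem_ofPred_eq] at ha hb ⊢
    rw [map_mul]
    change π.toHom a (π.toHom b v) = v
    rw [hb, ha]
  inv_mem' {a} ha := by
    simp only [Set.mem_ofPred_eq] at ha ⊢
    rw [map_inv]
    exact (π.toHom a).symm_apply_eq.2 ha.symm

/-- The dimension of the orbit `G v`, i.e. of its tangent space `{x · v : x ∈ 𝔤}` at `v`. -/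
def orbitDim (v : V) : ℕ := Module.finrank ℝ (LinearMap.range (π.infAct v))

/-- `v` is regular if its orbit has maximal dimension amongst all orbits. -/
def IsRegular (v : V) : Prop := ∀ w : V, π.orbitDim w ≤ π.orbitDim v

/-- `v` lies on a principal orbit: it is regular and its isotropy group has the least possible
number of connected components amongst the isotropy groups of regular elements. -/
def IsPrincipal (v : V) : Prop :=
  π.IsRegular v ∧ ∀ w : V, π.IsRegular w →
    ENat.card (ConnectedComponents (π.isotropy v)) ≤ ENat.card (ConnectedComponents (π.isotropy w))

/-- The dimension `m` of the principal orbits, i.e. the maximal dimension of an orbit. -/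
def maxDim : ℕ := ⨆ v : V, π.orbitDim v

/-- The index `k` of the covering `G/H → G v = G/G_v` for regular `v`, where `H` is a principal
isotropy group contained in `G_v`. By the principal orbit type theorem such an `H` exists for every
regular `v`, and `[G_v : H]` does not depend on it. -/
def coveringIndex (v : V) : ℕ :=
  sInf {k | ∃ u : V, π.IsPrincipal u ∧ π.isotropy u ≤ π.isotropy v ∧
    k = (π.isotropy u).relIndex (π.isotropy v)}

/-- The `m`-dimensional volume of the orbit `G v`, for the metric induced from `V`. -/
def orbitVolume [MeasurableSpace V] [BorelSpace V] (v : V) : ℝ :=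
  (μHE[π.maxDim] (π.orbit v)).toReal

open Classical in
/-- The discriminant `δ` of the representation. -/
def discriminant [MeasurableSpace V] [BorelSpace V] (v : V) : ℝ :=
  if π.IsRegular v then (π.coveringIndex v : ℝ) ^ 2 * π.orbitVolume v ^ 2 else 0

/-- The representation is polar: some linear subspace meets every orbit, and meets every orbit
orthogonally. -/
def IsPolar : Prop :=
  ∃ c : Submodule ℝ V, (∀ v : V, ∃ u ∈ c, u ∈ π.orbit v) ∧
    ∀ u ∈ c, ∀ x : LieAlg E G, ∀ w ∈ c, inner ℝ (π.infAct u x) w = 0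

/-- The space `Λᵐ𝔤 ⊗ ΛᵐV`, where `m` is the dimension of the principal orbits. -/
abbrev MinorSpace : Type _ := (⋀[ℝ]^π.maxDim (LieAlg E G)) ⊗[ℝ] (⋀[ℝ]^π.maxDim V)

/-- The action of `G` on `Λᵐ𝔤 ⊗ ΛᵐV`. -/
def minorRep [LieGroup 𝓘(ℝ, E) ∞ G] : Representation ℝ G π.MinorSpace :=
  (extPower (adRep E G) π.maxDim).tprod (extPower π.rep π.maxDim)

section FiniteDim

variable [FiniteDimensional ℝ V]

/-- The function-valued form of the minor map: `minorFun (ξ ⊗ η) v = ⟨Λᵐ(x ↦ x · v) ξ, η⟩`. -/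
def minorFun : π.MinorSpace →ₗ[ℝ] V → ℝ :=
  LinearMap.pi fun v =>
    TensorProduct.lift (innerₗ (⋀[ℝ]^π.maxDim V) ∘ₗ exteriorPower.map π.maxDim (π.infAct v))

theorem minorFun_tmul (x : Fin π.maxDim → LieAlg E G) (y : Fin π.maxDim → V) (v : V) :
    π.minorFun (exteriorPower.ιMulti ℝ _ x ⊗ₜ exteriorPower.ιMulti ℝ _ y) v
      = Matrix.det (Matrix.of fun i j => inner ℝ (π.infAct v (x j)) (y i)) := by
  simp only [minorFun, LinearMap.pi_apply, TensorProduct.lift.tmul, LinearMap.comp_apply,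
    innerₗ_apply_apply, exteriorPower.map_apply_ιMulti, exteriorPower.inner_ιMulti_ιMulti]
  rfl

theorem minorFun_mem (t : π.MinorSpace) : π.minorFun t ∈ homogPoly V π.maxDim := by
  suffices h : ∀ (a : ⋀[ℝ]^π.maxDim (LieAlg E G)) (b : ⋀[ℝ]^π.maxDim V),
      π.minorFun (a ⊗ₜ b) ∈ homogPoly V π.maxDim by
    induction t using TensorProduct.induction_on with
    | zero => rw [map_zero]; exact zero_mem _
    | tmul a b => exact h a b
    | add s t hs ht => rw [map_add]; exact add_mem hs ht
  intro a b
  have ha : a ∈ Submodule.span ℝ (Set.range (exteriorPower.ιMulti ℝ π.maxDim (M := LieAlg E G))) :=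
    by rw [exteriorPower.ιMulti_span]; trivial
  have hb : b ∈ Submodule.span ℝ (Set.range (exteriorPower.ιMulti ℝ π.maxDim (M := V))) :=
    by rw [exteriorPower.ιMulti_span]; trivial
  induction ha using Submodule.span_induction with
  | zero => rw [TensorProduct.zero_tmul, map_zero]; exact zero_mem _
  | add p q _ _ hp hq => rw [TensorProduct.add_tmul, map_add]; exact add_mem hp hq
  | smul r p _ hp =>
    rw [← TensorProduct.smul_tmul', map_smul]; exact Submodule.smul_mem _ _ hp
  | mem p hp =>
    obtain ⟨x, rfl⟩ := hp
    induction hb using Submodule.span_induction with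
    | zero => rw [TensorProduct.tmul_zero, map_zero]; exact zero_mem _
    | add p q _ _ hp hq => rw [TensorProduct.tmul_add, map_add]; exact add_mem hp hq
    | smul r p _ hp =>
      rw [TensorProduct.tmul_smul, map_smul]; exact Submodule.smul_mem _ _ hp
    | mem q hq =>
      obtain ⟨y, rfl⟩ := hq
      have : π.minorFun (exteriorPower.ιMulti ℝ _ x ⊗ₜ exteriorPower.ιMulti ℝ _ y)
          = ∑ σ : Equiv.Perm (Fin π.maxDim), ((Equiv.Perm.sign σ : ℤ) : ℝ) •
              fun v => ∏ i, ((innerₗ V (y (σ i))) ∘ₗ (π.infAct.flip (x i))) v := by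
        funext v
        rw [minorFun_tmul, Matrix.det_apply']
        simp [real_inner_comm]
      rw [this]
      exact Submodule.sum_mem _ fun σ _ =>
        Submodule.smul_mem _ _ (Submodule.subset_span ⟨_, rfl⟩)

/-- The equivariant minor map `Φ : Λᵐ𝔤 ⊗ ΛᵐV → ℝ[V]_m`,
`Φ(x₁ ∧ ⋯ ∧ x_m ⊗ v₁ ∧ ⋯ ∧ v_m)(v) = ⟨x₁·v ∧ ⋯ ∧ x_m·v, v₁ ∧ ⋯ ∧ v_m⟩`. -/
def minorMap : π.MinorSpace →ₗ[ℝ] homogPoly V π.maxDim :=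
  π.minorFun.codRestrict _ π.minorFun_mem

variable [FiniteDimensional ℝ E]

/-- The inner product on `Λᵐ𝔤 ⊗ ΛᵐV` induced by the inner product `B` on `𝔤` and that of `V`. -/
def minorInner (B : InnerProductSpace.Core ℝ (LieAlg E G)) (s t : π.MinorSpace) : ℝ :=
  letI : NormedAddCommGroup (LieAlg E G) := B.toNormedAddCommGroup
  letI : InnerProductSpace ℝ (LieAlg E G) := InnerProductSpace.ofCore B.toCore
  inner ℝ s t

/-- A basis of a subspace of `Λᵐ𝔤 ⊗ ΛᵐV` is orthonormal. -/
def IsOrthonormalBasis (B : InnerProductSpace.Core ℝ (LieAlg E G)) {W : Submodule ℝ π.MinorSpace}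
    {n : ℕ} (w : Module.Basis (Fin n) ℝ W) : Prop :=
  ∀ i j, π.minorInner B (w i : π.MinorSpace) (w j) = if i = j then 1 else 0

end FiniteDim

end OrthogonalRep

end PolarDisc

end

/-!
Let `c` be a section: a subspace which meets every orbit, and meets it orthogonally. The point of
the proof is that both sides of the identity transform by the same factor along `c`.

*The factor.* At a regular `w ∈ c` the section is the whole orthogonal complement of the tangent
space `𝔤 · w` of the orbit (`IsSection.tan_orthogonal_eq`). For every `u ∈ c` the infinitesimal
action factors as `x · u = A_u (x · w)` for an endomorphism `A_u` of `𝔤 · w`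
(`SliceChart.relMap`), because `𝔤 · u` is orthogonal to `c`, hence contained in `𝔤 · w`, and
because `x · w = 0` forces `x · u = 0` (`IsSection.infCLM_eq_zero`).

*Minors.* Since `𝔤 · w` has dimension `m`, `Λᵐ A_u` is multiplication by `det A_u`, so every minor
satisfies `Φ(t)(u) = det A_u · Φ(t)(w)` (`IsSection.minorFun_eq`).

*Orbits.* The point `w` can be chosen such that its isotropy group fixes `c` pointwise
(`IsSection.exists_isotropy_eq_fixer`), and then it is principal. If `u` is regular, the
equivariant map `G w → G u` is a covering with `[G_u : G_w]` sheets, and this number is the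
covering index (`IsSection.coveringIndex_eq`). Up to isometries, the differential of this map is
`A_u` at each point. Covering `G w` by disjoint translates of small pieces on which the map is
nearly linear (`exists_nhds_measure_image_bounds`), and counting sheets (`measure_pieces`), gives
`[G_u : G_w] · vol (G u) = |det A_u| · vol (G w)`, that is, `δ(u) = (det A_u)² · vol (G w)²`
(`IsSection.discriminant_eq`). Where `u` is not regular, both sides vanish.

*Conclusion.* For an orthonormal basis of an invariant `W`, the sum `∑ Φ(wᵢ)²` does not depend on
the basis, hence is a `G`-invariant function. It therefore suffices to compare it with `δ` on `c`,
where both are constant multiples of `(det A_u)²`, with constants which are positive as soon as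
`Φ(W) ≠ 0`. An invariant subspace `U` of the image of `Φ` lifts isomorphically to the orthogonal
complement of the kernel of `Φ`, and the image of a rescaled orthonormal basis of the lift is the
basis sought.
-/

set_option linter.unusedSectionVars false

noncomputable section

namespace PolarDisc

open Filter Topology Set Module MeasureTheory
open scoped NNReal ENNReal

/-! ### Local parametrization of the group and the infinitesimal action -/

section Chart

variable (E G : Type*) [NormedAddCommGroup E] [NormedSpace ℝ E]
  [TopologicalSpace G] [ChartedSpace E G] [Group G]

/-- The parametrization of a neighbourhood of `1 ∈ G` by the model space, centred so that `0` is
sent to `1`: the inverse of the preferred chart at `1`, precomposed with a translation. -/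
def chartParam (z : E) : G :=
  (extChartAt 𝓘(ℝ, E) (1 : G)).symm (extChartAt 𝓘(ℝ, E) (1 : G) 1 + z)

@[simp] theorem chartParam_zero : chartParam E G 0 = 1 := by
  simp [chartParam]

theorem eventually_add_mem_target : ∀ᶠ z in 𝓝 (0 : E),
    extChartAt 𝓘(ℝ, E) (1 : G) 1 + z ∈ (extChartAt 𝓘(ℝ, E) (1 : G)).target := by
  have h : Tendsto (fun z : E => extChartAt 𝓘(ℝ, E) (1 : G) 1 + z) (𝓝 0)
      (𝓝 (extChartAt 𝓘(ℝ, E) (1 : G) 1)) := by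
    have : Continuous (fun z : E => extChartAt 𝓘(ℝ, E) (1 : G) 1 + z) := by fun_prop
    simpa using this.tendsto 0
  exact h.eventually (extChartAt_target_mem_nhds (I := 𝓘(ℝ, E)) (1 : G))

theorem eventually_contMDiffAt_chartParam [IsManifold 𝓘(ℝ, E) ∞ G] :
    ∀ᶠ z in 𝓝 (0 : E), ContMDiffAt 𝓘(ℝ, E) 𝓘(ℝ, E) ∞ (chartParam E G) z := by
  filter_upwards [eventually_add_mem_target E G] with z hz
  have h1 : ContMDiffAt 𝓘(ℝ, E) 𝓘(ℝ, E) ∞ (extChartAt 𝓘(ℝ, E) (1 : G)).symm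
      (extChartAt 𝓘(ℝ, E) (1 : G) 1 + z) :=
    (contMDiffOn_extChartAt_symm (1 : G)).contMDiffAt
      ((isOpen_extChartAt_target (I := 𝓘(ℝ, E)) (1 : G)).mem_nhds hz)
  have h2 : ContMDiffAt 𝓘(ℝ, E) 𝓘(ℝ, E) ∞
      (fun z : E => extChartAt 𝓘(ℝ, E) (1 : G) 1 + z) z :=
    (contDiff_const.add contDiff_id).contDiffAt.contMDiffAt
  exact h1.comp z h2

/-- The parametrization covers neighbourhoods of `1`. -/
theorem nhds_one_le_map_chartParam : 𝓝 (1 : G) ≤ map (chartParam E G) (𝓝 0) := by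
  intro s hs
  rw [mem_map] at hs
  have h1 : Tendsto (fun g : G => extChartAt 𝓘(ℝ, E) (1 : G) g - extChartAt 𝓘(ℝ, E) (1 : G) 1)
      (𝓝 1) (𝓝 0) := by
    have := ((continuousAt_extChartAt (I := 𝓘(ℝ, E)) (1 : G)).tendsto).sub_const
      (extChartAt 𝓘(ℝ, E) (1 : G) 1)
    simpa using this
  filter_upwards [h1 hs, extChartAt_source_mem_nhds (I := 𝓘(ℝ, E)) (1 : G)] with g hg hg'
  have : chartParam E G (extChartAt 𝓘(ℝ, E) (1 : G) g - extChartAt 𝓘(ℝ, E) (1 : G) 1) = g := by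
    simp only [chartParam, add_sub_cancel]
    exact (extChartAt 𝓘(ℝ, E) (1 : G)).left_inv hg'
  rw [← this]
  exact hg

end Chart

namespace OrthogonalRep

variable {E G V : Type*} [NormedAddCommGroup E] [NormedSpace ℝ E]
  [TopologicalSpace G] [ChartedSpace E G] [Group G]
  [NormedAddCommGroup V] [InnerProductSpace ℝ V] (π : OrthogonalRep E G V)

@[simp] theorem toHom_mul_apply (g h : G) (v : V) : π.toHom (g * h) v = π.toHom g (π.toHom h v) := by
  rw [map_mul]; rfl

@[simp] theorem toHom_one_apply (v : V) : π.toHom 1 v = v := by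
  rw [map_one]; rfl

@[simp] theorem toHom_inv_toHom (g : G) (v : V) : π.toHom g⁻¹ (π.toHom g v) = v := by
  rw [← toHom_mul_apply]; simp

@[simp] theorem toHom_toHom_inv (g : G) (v : V) : π.toHom g (π.toHom g⁻¹ v) = v := by
  rw [← toHom_mul_apply]; simp

theorem continuous_toHom_apply (v : V) : Continuous fun g : G => π.toHom g v :=
  (π.smooth v).continuous

theorem mem_isotropy {g : G} {v : V} : g ∈ π.isotropy v ↔ π.toHom g v = v := Iff.rfl

/-- The action, locally near `1`, as a family of continuous linear maps on the model space. -/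
def localAct (z : E) : V →L[ℝ] V :=
  ((π.toHom (chartParam E G z)).toContinuousLinearEquiv : V →L[ℝ] V)

theorem localAct_apply (z : E) (v : V) : π.localAct z v = π.toHom (chartParam E G z) v := rfl

@[simp] theorem localAct_zero : π.localAct 0 = ContinuousLinearMap.id ℝ V := by
  ext v; simp [localAct_apply]

/-- The infinitesimal action `x ↦ x · v`, as a continuous linear map on the model space. -/
def infCLM (v : V) : E →L[ℝ] V := mvfderiv 𝓘(ℝ, E) (fun g : G => π.toHom g v) 1

theorem infCLM_apply (v : V) (x : E) : π.infCLM v x = π.infAct v x := rfl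

theorem hasMFDerivAt_toHom (v : V) :
    HasMFDerivAt 𝓘(ℝ, E) 𝓘(ℝ, V) (fun g : G => π.toHom g v) 1 (π.infCLM v) :=
  (((π.smooth v).contMDiffAt (x := (1 : G))).mdifferentiableAt (by simp)).hasMFDerivAt

variable [LieGroup 𝓘(ℝ, E) ∞ G] [FiniteDimensional ℝ V]

/-- The derivative of `y ↦ f(y) · v`, at a point where `f = 1`, factors through the infinitesimal
action at `v`. -/
theorem hasFDerivAt_toHom_comp {f : E → G} {z : E} (hf : MDifferentiableAt 𝓘(ℝ, E) 𝓘(ℝ, E) f z)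
    (hz : f z = 1) (v : V) :
    ∃ D : E →L[ℝ] E, HasFDerivAt (fun y => π.toHom (f y) v) (π.infCLM v ∘L D) z := by
  refine ⟨(show E →L[ℝ] E from mfderiv 𝓘(ℝ, E) 𝓘(ℝ, E) f z), ?_⟩
  have h1 := π.hasMFDerivAt_toHom v
  rw [← hz] at h1
  exact (h1.comp z hf.hasMFDerivAt).hasFDerivAt

theorem eventually_contDiffAt_localAct :
    ∀ᶠ z in 𝓝 (0 : E), ContDiffAt ℝ 1 π.localAct z := by
  have h := eventually_contMDiffAt_chartParam E G
  obtain ⟨U, hU, hUo, h0⟩ := eventually_nhds_iff.1 h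
  refine eventually_nhds_iff.2 ⟨U, fun z hz => ?_, hUo, h0⟩
  have : ContDiffOn ℝ 1 π.localAct U := by
    refine contDiffOn_clm_apply.2 fun v y hy => ?_
    have h1 : ContMDiffAt 𝓘(ℝ, E) 𝓘(ℝ, V) ∞ ((fun g : G => π.toHom g v) ∘ chartParam E G) y :=
      (π.smooth v).contMDiffAt.comp y (hU y hy)
    exact (h1.contDiffAt.of_le (by norm_cast)).contDiffWithinAt
  exact this.contDiffAt (hUo.mem_nhds hz)

/-- Right translation moves the derivative of `z ↦ ψ(z) v` at `z` to that of an orbit map at `1`, so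
it takes values in the tangent space of the orbit at `ψ(z) v`. -/
theorem eventually_range_fderiv_localAct_le :
    ∀ᶠ z in 𝓝 (0 : E), ∀ v : V, ∀ x : E,
      fderiv ℝ π.localAct z x v ∈ LinearMap.range (π.infAct (π.localAct z v)) := by
  filter_upwards [eventually_contMDiffAt_chartParam E G, π.eventually_contDiffAt_localAct]
    with z hz hz' v x
  have hf : MDifferentiableAt 𝓘(ℝ, E) 𝓘(ℝ, E)
      (fun y => chartParam E G y * (chartParam E G z)⁻¹) z :=
    ContMDiffAt.mdifferentiableAt (n := ∞) (hz.mul contMDiffAt_const) (by simp)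
  obtain ⟨D, hD⟩ := π.hasFDerivAt_toHom_comp hf (by simp) (π.localAct z v)
  have h1 : HasFDerivAt (fun y => π.localAct y v)
      ((ContinuousLinearMap.apply ℝ V v) ∘L fderiv ℝ π.localAct z) z :=
    (ContinuousLinearMap.apply ℝ V v).hasFDerivAt.comp z
      (hz'.differentiableAt (by simp)).hasFDerivAt
  have h2 : (fun y => π.toHom (chartParam E G y * (chartParam E G z)⁻¹) (π.localAct z v))
      = fun y => π.localAct y v := by
    funext y
    simp [localAct_apply]
  rw [h2] at hD
  have h3 := congrArg (fun T : E →L[ℝ] V => T x) (h1.unique hD)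
  simp only [ContinuousLinearMap.comp_apply, ContinuousLinearMap.apply_apply] at h3
  exact ⟨D x, h3.symm⟩

/-- The parametrization near `1` realizes the identification of `E` with the tangent space at `1`. -/
theorem hasFDerivAt_comp_chartParam {f : G → V} (hf : MDifferentiableAt 𝓘(ℝ, E) 𝓘(ℝ, V) f 1) :
    HasFDerivAt (fun z : E => f (chartParam E G z)) (show E →L[ℝ] V from mvfderiv 𝓘(ℝ, E) f 1) 0 := by
  have h1 : HasFDerivWithinAt (f ∘ (extChartAt 𝓘(ℝ, E) (1 : G)).symm)
      (show E →L[ℝ] V from mvfderiv 𝓘(ℝ, E) f 1) (range 𝓘(ℝ, E))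
      (extChartAt 𝓘(ℝ, E) (1 : G) 1) := hf.hasMFDerivAt.2
  rw [modelWithCornersSelf_coe, range_id, hasFDerivWithinAt_univ] at h1
  have h2 : HasFDerivAt (fun z : E => extChartAt 𝓘(ℝ, E) (1 : G) 1 + z)
      (ContinuousLinearMap.id ℝ E) 0 := (hasFDerivAt_id (0 : E)).const_add _
  have h1' : HasFDerivAt (f ∘ (extChartAt 𝓘(ℝ, E) (1 : G)).symm)
      (show E →L[ℝ] V from mvfderiv 𝓘(ℝ, E) f 1) (extChartAt 𝓘(ℝ, E) (1 : G) 1 + 0) := by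
    rw [add_zero]; exact h1
  exact h1'.comp (0 : E) h2

theorem fderiv_localAct_zero (x : E) (v : V) :
    fderiv ℝ π.localAct 0 x v = π.infAct v x := by
  have hz' := π.eventually_contDiffAt_localAct.self_of_nhds
  have h1 : HasFDerivAt (fun y => π.localAct y v)
      ((ContinuousLinearMap.apply ℝ V v) ∘L fderiv ℝ π.localAct 0) 0 :=
    (ContinuousLinearMap.apply ℝ V v).hasFDerivAt.comp 0
      (hz'.differentiableAt (by simp)).hasFDerivAt
  have h2 : HasFDerivAt (fun y => π.localAct y v) (π.infCLM v) 0 :=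
    hasFDerivAt_comp_chartParam
      (((π.smooth v).contMDiffAt (x := (1 : G))).mdifferentiableAt (by simp))
  have h3 := congrArg (fun T : E →L[ℝ] V => T x) (h1.unique h2)
  exact h3

/-- The infinitesimal action is equivariant: `g (x · v) = (Ad_g x) · (g v)`. -/
theorem toHom_infAct (g : G) (v : V) (x : LieAlg E G) :
    π.toHom g (π.infAct v x) = π.infAct (π.toHom g v) (adRep E G g x) := by
  have hf : MDifferentiableAt 𝓘(ℝ, E) 𝓘(ℝ, E) (fun h : G => g * h * g⁻¹) 1 :=
    ContMDiffAt.mdifferentiableAt (n := ∞)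
      (((contMDiff_const.mul contMDiff_id).mul contMDiff_const).contMDiffAt) (by simp)
  have h1 := π.hasMFDerivAt_toHom (π.toHom g v)
  have e1 : (1 : G) = g * 1 * g⁻¹ := by simp
  rw [e1] at h1
  have h2 := h1.comp (1 : G) hf.hasMFDerivAt
  have h3 : HasMFDerivAt 𝓘(ℝ, E) 𝓘(ℝ, V) (fun h : G => π.toHom g (π.toHom h v)) 1
      (((π.toHom g).toContinuousLinearEquiv : V →L[ℝ] V) ∘L π.infCLM v) := by
    have h4 : HasMFDerivAt 𝓘(ℝ, V) 𝓘(ℝ, V) (π.toHom g) (π.toHom 1 v)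
        ((π.toHom g).toContinuousLinearEquiv : V →L[ℝ] V) :=
      ((π.toHom g).toContinuousLinearEquiv : V →L[ℝ] V).hasFDerivAt.hasMFDerivAt
    exact h4.comp (1 : G) (π.hasMFDerivAt_toHom v)
  have e2 : ((fun h : G => π.toHom h (π.toHom g v)) ∘ fun h : G => g * h * g⁻¹)
      = fun h : G => π.toHom g (π.toHom h v) := by
    funext h; simp
  rw [e2] at h2
  have h5 := hasMFDerivAt_unique h3 h2
  exact congrArg (fun T : E →L[ℝ] V => T x) h5

/-- The infinitesimal action is skew-symmetric. -/
theorem inner_infAct_left (x : LieAlg E G) (v w : V) :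
    inner ℝ (π.infAct v x) w = - inner ℝ v (π.infAct w x) := by
  have hd : ∀ v : V, HasFDerivAt (fun y => π.localAct y v) (π.infCLM v) 0 := fun v =>
    hasFDerivAt_comp_chartParam
      (((π.smooth v).contMDiffAt (x := (1 : G))).mdifferentiableAt (by simp))
  have h1 := (hd v).inner ℝ (hd w)
  have h2 : (fun t => inner ℝ (π.localAct t v) (π.localAct t w)) = fun _ : E => inner ℝ v w := by
    funext t; simp [localAct_apply, LinearIsometryEquiv.inner_map_map]
  rw [h2] at h1
  have h3 := congrArg (fun T : E →L[ℝ] ℝ => T x) (h1.unique (hasFDerivAt_const _ _))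
  simp only [localAct_zero, ContinuousLinearMap.id_apply] at h3
  have h4 : inner ℝ v (π.infCLM w x) + inner ℝ (π.infCLM v x) w = 0 := h3
  change inner ℝ (π.infCLM v x) w = - inner ℝ v (π.infCLM w x)
  linarith

end OrthogonalRep

/-! ### Regular points and slice coordinates -/

namespace OrthogonalRep

variable {E G V : Type*} [NormedAddCommGroup E] [NormedSpace ℝ E]
  [TopologicalSpace G] [ChartedSpace E G] [Group G]
  [NormedAddCommGroup V] [InnerProductSpace ℝ V] (π : OrthogonalRep E G V)

/-- The tangent space `𝔤 · v` of the orbit `G v` at `v`. -/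
def tan (v : V) : Submodule ℝ V := LinearMap.range (π.infAct v)

theorem infCLM_mem_tan (v : V) (x : E) : π.infCLM v x ∈ π.tan v := ⟨x, rfl⟩

theorem orbitDim_eq_finrank_tan (v : V) : π.orbitDim v = finrank ℝ (π.tan v) := rfl

variable [FiniteDimensional ℝ V]

theorem bddAbove_orbitDim : BddAbove (range π.orbitDim) :=
  ⟨finrank ℝ V, by rintro _ ⟨v, rfl⟩; exact Submodule.finrank_le _⟩

theorem orbitDim_le_maxDim (v : V) : π.orbitDim v ≤ π.maxDim :=
  le_ciSup π.bddAbove_orbitDim v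

theorem exists_orbitDim_eq_maxDim : ∃ v, π.orbitDim v = π.maxDim :=
  Nat.sSup_mem (range_nonempty π.orbitDim) π.bddAbove_orbitDim

theorem isRegular_iff {v : V} : π.IsRegular v ↔ π.orbitDim v = π.maxDim := by
  refine ⟨fun h => le_antisymm (π.orbitDim_le_maxDim v) (ciSup_le h), fun h w => ?_⟩
  rw [h]; exact π.orbitDim_le_maxDim w

theorem exists_isRegular : ∃ v, π.IsRegular v := by
  obtain ⟨v, hv⟩ := π.exists_orbitDim_eq_maxDim
  exact ⟨v, π.isRegular_iff.2 hv⟩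

theorem IsRegular.finrank_tan {π : OrthogonalRep E G V} {v : V} (hv : π.IsRegular v) :
    finrank ℝ (π.tan v) = π.maxDim := π.isRegular_iff.1 hv

variable [LieGroup 𝓘(ℝ, E) ∞ G]

theorem toHom_mem_tan {g : G} {v t : V} (ht : t ∈ π.tan v) :
    π.toHom g t ∈ π.tan (π.toHom g v) := by
  obtain ⟨x, rfl⟩ := ht
  exact ⟨_, (π.toHom_infAct g v x).symm⟩

theorem tan_toHom (g : G) (v : V) :
    π.tan (π.toHom g v) = (π.tan v).map (π.toHom g).toLinearEquiv.toLinearMap := by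
  apply le_antisymm
  · intro t ht
    have h := π.toHom_mem_tan (g := g⁻¹) ht
    rw [toHom_inv_toHom] at h
    exact ⟨_, h, π.toHom_toHom_inv g t⟩
  · rintro _ ⟨t, ht, rfl⟩
    exact π.toHom_mem_tan ht

theorem orbitDim_toHom (g : G) (v : V) : π.orbitDim (π.toHom g v) = π.orbitDim v := by
  rw [orbitDim_eq_finrank_tan, tan_toHom, orbitDim_eq_finrank_tan]
  exact LinearEquiv.finrank_map_eq (π.toHom g).toLinearEquiv (π.tan v)

theorem isRegular_toHom {g : G} {v : V} : π.IsRegular (π.toHom g v) ↔ π.IsRegular v := by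
  rw [isRegular_iff, isRegular_iff, orbitDim_toHom]

theorem inner_infCLM_left (x : E) (v w : V) :
    inner ℝ (π.infCLM v x) w = - inner ℝ v (π.infCLM w x) := π.inner_infAct_left x v w

theorem self_mem_tan_orthogonal (w : V) : w ∈ (π.tan w)ᗮ := by
  rw [Submodule.mem_orthogonal]
  rintro _ ⟨x, rfl⟩
  have h : inner ℝ (π.infCLM w x) w = - inner ℝ w (π.infCLM w x) := π.inner_infCLM_left x w w
  have h' := real_inner_comm (F := V) (π.infCLM w x) w
  change inner ℝ (π.infCLM w x) w = 0
  linarith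

/-- The projection onto the tangent space of the orbit. -/
def tanProj (w : V) : V →L[ℝ] V := (π.tan w).starProjection

/-- The projection onto the normal space of the orbit. -/
def norProj (w : V) : V →L[ℝ] V := (π.tan w)ᗮ.starProjection

theorem tanProj_add_norProj (w v : V) : π.tanProj w v + π.norProj w v = v :=
  Submodule.starProjection_add_starProjection_orthogonal v

theorem tanProj_mem (w v : V) : π.tanProj w v ∈ π.tan w := Submodule.starProjection_apply_mem _ _

theorem norProj_mem (w v : V) : π.norProj w v ∈ (π.tan w)ᗮ := Submodule.starProjection_apply_mem _ _

theorem tanProj_of_mem {w v : V} (h : v ∈ π.tan w) : π.tanProj w v = v :=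
  Submodule.starProjection_eq_self_iff.2 h

theorem norProj_of_mem {w v : V} (h : v ∈ (π.tan w)ᗮ) : π.norProj w v = v :=
  Submodule.starProjection_eq_self_iff.2 h

theorem norProj_of_mem_tan {w v : V} (h : v ∈ π.tan w) : π.norProj w v = 0 := by
  have := π.tanProj_add_norProj w v
  rw [π.tanProj_of_mem h] at this
  simpa using this

theorem tanProj_of_mem_orthogonal {w v : V} (h : v ∈ (π.tan w)ᗮ) : π.tanProj w v = 0 := by
  have := π.tanProj_add_norProj w v
  rw [π.norProj_of_mem h] at this
  simpa using this

/-- Slice coordinates at `w`: a linear right inverse `s` of the infinitesimal action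
`𝔤 → 𝔤 · w`, extended by zero to the normal space, and the map
`v ↦ ψ(s v) · (normal part of v)` as a local diffeomorphism of `V` fixing `w`, where `ψ` is the
parametrization of `G` near `1`. -/
structure SliceChart (w : V) where
  /-- the right inverse of the infinitesimal action -/
  s : V →L[ℝ] E
  infCLM_s : ∀ t, π.infCLM w (s t) = π.tanProj w t
  s_normal : ∀ y ∈ (π.tan w)ᗮ, s y = 0
  /-- the local diffeomorphism -/
  chart : OpenPartialHomeomorph V V
  chart_apply : ∀ v, chart v = π.localAct (s v) (π.norProj w v)
  mem_source : w ∈ chart.source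

variable {π}

/-- The normal part of the slice coordinates; it is constant on local orbits. -/
def SliceChart.nor {w : V} (S : π.SliceChart w) (v : V) : V := π.norProj w (S.chart.symm v)

variable (π) in
theorem contDiffAt_slice {w : V} (s : V →L[ℝ] E) (p : V) (h : ContDiffAt ℝ 1 π.localAct (s p)) :
    ContDiffAt ℝ 1 (fun v => π.localAct (s v) (π.norProj w v)) p :=
  ContDiffAt.clm_apply (h.comp p s.contDiff.contDiffAt) (π.norProj w).contDiff.contDiffAt

variable (π) in
theorem hasFDerivAt_slice {w : V} (s : V →L[ℝ] E) (p : V) (h : ContDiffAt ℝ 1 π.localAct (s p)) :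
    HasFDerivAt (fun v => π.localAct (s v) (π.norProj w v))
      ((π.localAct (s p)) ∘L (π.norProj w) +
        ((fderiv ℝ π.localAct (s p)) ∘L s).flip (π.norProj w p)) p :=
  HasFDerivAt.clm_apply ((h.differentiableAt (by simp)).hasFDerivAt.comp p s.hasFDerivAt)
    (π.norProj w).hasFDerivAt

variable (π) in
theorem hasFDerivAt_slice_self {w : V} (s : V →L[ℝ] E)
    (hs : ∀ t, π.infCLM w (s t) = π.tanProj w t) (hs' : ∀ y ∈ (π.tan w)ᗮ, s y = 0) :
    HasFDerivAt (fun v => π.localAct (s v) (π.norProj w v))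
      (ContinuousLinearEquiv.refl ℝ V : V →L[ℝ] V) w := by
  have h0 : s w = 0 := hs' w (π.self_mem_tan_orthogonal w)
  have h := π.hasFDerivAt_slice (w := w) s w
    (by rw [h0]; exact π.eventually_contDiffAt_localAct.self_of_nhds)
  convert h using 1
  ext v
  have h1 := π.fderiv_localAct_zero (s v) w
  simp only [ContinuousLinearEquiv.coe_refl, ContinuousLinearMap.id_apply,
    add_apply, ContinuousLinearMap.comp_apply, h0, localAct_zero,
    ContinuousLinearMap.flip_apply, π.norProj_of_mem (π.self_mem_tan_orthogonal w), h1]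
  rw [← infCLM_apply, hs, add_comm, tanProj_add_norProj]

variable (π) in
theorem nonempty_sliceChart [FiniteDimensional ℝ E] (w : V) : Nonempty (π.SliceChart w) := by
  obtain ⟨s₀, hs₀⟩ := LinearMap.exists_rightInverse_of_surjective
    ((π.infCLM w : E →ₗ[ℝ] V).rangeRestrict) (LinearMap.range_rangeRestrict _)
  let s : V →L[ℝ] E := (LinearMap.toContinuousLinearMap s₀) ∘L (π.tan w).orthogonalProjectionOnto
  have hs : ∀ t, π.infCLM w (s t) = π.tanProj w t := fun t => by
    have := congrArg Subtype.val
      (LinearMap.congr_fun hs₀ ((π.tan w).orthogonalProjectionOnto t))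
    exact this
  have hs' : ∀ y ∈ (π.tan w)ᗮ, s y = 0 := fun y hy => by
    have : (π.tan w).orthogonalProjectionOnto y = 0 :=
      Submodule.orthogonalProjectionOnto_eq_zero_iff.2 hy
    exact (congrArg s₀ this).trans s₀.map_zero
  have h0 : s w = 0 := hs' w (π.self_mem_tan_orthogonal w)
  have hc := π.contDiffAt_slice (w := w) s w
    (by rw [h0]; exact π.eventually_contDiffAt_localAct.self_of_nhds)
  have hd := π.hasFDerivAt_slice_self s hs hs'
  exact ⟨⟨s, hs, hs', hc.toOpenPartialHomeomorph _ hd (by simp), fun v => rfl,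
    hc.mem_toOpenPartialHomeomorph_source hd (by simp)⟩⟩

namespace SliceChart

variable {w : V} (S : π.SliceChart w)

theorem coe_chart : (S.chart : V → V) = fun v => π.localAct (S.s v) (π.norProj w v) :=
  funext S.chart_apply

@[simp] theorem s_self : S.s w = 0 := S.s_normal w (π.self_mem_tan_orthogonal w)

theorem chart_of_normal {y : V} (hy : y ∈ (π.tan w)ᗮ) : S.chart y = y := by
  rw [chart_apply, S.s_normal y hy, π.norProj_of_mem hy, localAct_zero]; rfl

@[simp] theorem chart_self : S.chart w = w := S.chart_of_normal (π.self_mem_tan_orthogonal w)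

theorem mem_target : w ∈ S.chart.target := by
  have := S.chart.map_source S.mem_source
  rwa [S.chart_self] at this

@[simp] theorem symm_self : S.chart.symm w = w := by
  have := S.chart.left_inv S.mem_source
  rwa [S.chart_self] at this

theorem eventually_nor_of_normal : ∀ᶠ y in 𝓝 w, y ∈ (π.tan w)ᗮ → S.nor y = y := by
  filter_upwards [S.chart.open_source.mem_nhds S.mem_source] with y hy hy'
  have h := S.chart.left_inv hy
  rw [S.chart_of_normal hy'] at h
  rw [nor, h, π.norProj_of_mem hy']

@[simp] theorem nor_self : S.nor w = w :=
  S.eventually_nor_of_normal.self_of_nhds (π.self_mem_tan_orthogonal w)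

theorem hasFDerivAt_chart_self :
    HasFDerivAt S.chart (ContinuousLinearEquiv.refl ℝ V : V →L[ℝ] V) w := by
  rw [coe_chart]; exact π.hasFDerivAt_slice_self S.s S.infCLM_s S.s_normal

theorem tendsto_s : Tendsto S.s (𝓝 w) (𝓝 0) := by
  have := S.s.continuous.tendsto w
  rwa [S.s_self] at this

theorem tendsto_symm : Tendsto S.chart.symm (𝓝 w) (𝓝 w) := by
  have := (S.chart.continuousAt_symm S.mem_target).tendsto
  rwa [S.symm_self] at this

theorem contDiffAt_chart_self : ContDiffAt ℝ 1 S.chart w := by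
  rw [coe_chart]
  exact π.contDiffAt_slice S.s w
    (by rw [S.s_self]; exact π.eventually_contDiffAt_localAct.self_of_nhds)

theorem contDiffAt_symm : ContDiffAt ℝ 1 S.chart.symm w := by
  refine S.chart.contDiffAt_symm (f₀' := ContinuousLinearEquiv.refl ℝ V) S.mem_target ?_ ?_
  · rw [S.symm_self]; exact S.hasFDerivAt_chart_self
  · rw [S.symm_self]; exact S.contDiffAt_chart_self

theorem contDiffAt_nor : ContDiffAt ℝ 1 S.nor w :=
  (π.norProj w).contDiff.contDiffAt.comp w S.contDiffAt_symm

/-- Near a regular point all orbits have the same dimension, so the tangent spaces of the orbits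
are spanned by the tangential directions of the slice coordinates. Hence the normal coordinate has
zero derivative along orbits. -/
theorem eventually_isRegular_and_fderiv_nor_eq_zero (hw : π.IsRegular w) :
    ∀ᶠ v in 𝓝 w, π.IsRegular v ∧ ∀ t ∈ π.tan v, fderiv ℝ S.nor v t = 0 := by
  have e1 := S.tendsto_symm.eventually
    (S.contDiffAt_chart_self.eventually (by simp))
  have e2 := S.contDiffAt_symm.eventually (by simp)
  have e3 := (S.tendsto_s.comp S.tendsto_symm).eventually π.eventually_contDiffAt_localAct
  have e4 := (S.tendsto_s.comp S.tendsto_symm).eventually π.eventually_range_fderiv_localAct_le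
  have e5 := S.chart.open_target.mem_nhds S.mem_target
  filter_upwards [e1, e2, e3, e4, e5] with v h1 h2 h3 h4 h5
  set p := S.chart.symm v with hp
  have hpv : S.chart p = v := S.chart.right_inv h5
  have hp' : p ∈ S.chart.source := S.chart.map_target h5
  set D := fderiv ℝ S.chart p with hD
  set D' := fderiv ℝ S.chart.symm v with hD'
  have hd : HasFDerivAt S.chart D p := (h1.differentiableAt (by simp)).hasFDerivAt
  have hd' : HasFDerivAt S.chart.symm D' v := (h2.differentiableAt (by simp)).hasFDerivAt
  have hleft : D' ∘L D = ContinuousLinearMap.id ℝ V := by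
    have hd'' : HasFDerivAt S.chart.symm D' (S.chart p) := by rw [hpv]; exact hd'
    refine (hd''.comp p hd).unique ((hasFDerivAt_id p).congr_of_eventuallyEq ?_)
    filter_upwards [S.chart.open_source.mem_nhds hp'] with q hq
    exact S.chart.left_inv hq
  have hinj : Function.Injective (D : V →ₗ[ℝ] V) := fun a b hab => by
    have h := congrArg D' hab
    have ha := congrArg (fun T : V →L[ℝ] V => T a) hleft
    have hb := congrArg (fun T : V →L[ℝ] V => T b) hleft
    simp only [ContinuousLinearMap.comp_apply, ContinuousLinearMap.id_apply] at ha hb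
    rw [← ha, ← hb]; exact h
  have hle : (π.tan w).map (D : V →ₗ[ℝ] V) ≤ π.tan v := by
    rintro _ ⟨τ, hτ, rfl⟩
    have hd2 : D = _ := (hd.unique (by rw [S.coe_chart]; exact π.hasFDerivAt_slice S.s p h3))
    have h6 := h4 (π.norProj w p) (S.s τ)
    simp only [Function.comp_apply] at h6
    rw [← S.chart_apply, hpv] at h6
    have : D τ = fderiv ℝ π.localAct (S.s p) (S.s τ) (π.norProj w p) := by
      rw [hd2]; simp [π.norProj_of_mem_tan hτ]
    change D τ ∈ _
    rw [this]; exact h6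
  have heq : (π.tan w).map (D : V →ₗ[ℝ] V) = π.tan v := by
    refine Submodule.eq_of_le_of_finrank_le hle ?_
    rw [← (Submodule.equivMapOfInjective _ hinj (π.tan w)).finrank_eq]
    exact hw v
  constructor
  · rw [isRegular_iff, orbitDim_eq_finrank_tan, ← heq,
      ← (Submodule.equivMapOfInjective _ hinj (π.tan w)).finrank_eq, hw.finrank_tan]
  intro t ht
  rw [← heq] at ht
  obtain ⟨τ, hτ, rfl⟩ := ht
  have hn : HasFDerivAt S.nor ((π.norProj w) ∘L D') v := (π.norProj w).hasFDerivAt.comp v hd'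
  have h7 := congrArg (fun T : V →L[ℝ] V => T τ) hleft
  simp only [ContinuousLinearMap.comp_apply, ContinuousLinearMap.id_apply] at h7
  rw [hn.fderiv]
  change π.norProj w (D' (D τ)) = 0
  rw [h7, π.norProj_of_mem_tan hτ]

variable (π) in
theorem tendsto_localAct (w : V) :
    Tendsto (fun q : E × V => π.localAct q.1 q.2) (𝓝 0 ×ˢ 𝓝 w) (𝓝 w) := by
  have h : ContinuousAt (fun q : E × V => π.localAct q.1 q.2) (0, w) := by
    refine ContinuousAt.clm_apply ?_ continuousAt_snd
    have h1 : ContinuousAt π.localAct (Prod.fst (0, w)) :=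
      π.eventually_contDiffAt_localAct.self_of_nhds.continuousAt
    exact h1.comp continuousAt_fst
  have h2 := h.tendsto
  rw [nhds_prod_eq] at h2
  simpa using h2

/-- The normal slice coordinate at a regular point is locally invariant under the group. -/
theorem eventually_nor_localAct (hw : π.IsRegular w) :
    ∀ᶠ q in 𝓝 (0 : E) ×ˢ 𝓝 w, S.nor (π.localAct q.1 q.2) = S.nor q.2 := by
  have e1 := (tendsto_localAct π w).eventually
    ((S.eventually_isRegular_and_fderiv_nor_eq_zero hw).mono fun _ h => h.2)
  have e2 := (tendsto_localAct π w).eventually (S.contDiffAt_nor.eventually (by simp))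
  have e3 : ∀ᶠ q : E × V in 𝓝 (0 : E) ×ˢ 𝓝 w, _ :=
    tendsto_fst.eventually π.eventually_contDiffAt_localAct
  have e4 : ∀ᶠ q : E × V in 𝓝 (0 : E) ×ˢ 𝓝 w, _ :=
    tendsto_fst.eventually π.eventually_range_fderiv_localAct_le
  obtain ⟨P₁, h1, P₂, h2, h12⟩ := eventually_prod_iff.1 (((e1.and e2).and e3).and e4)
  obtain ⟨r, hr, hball⟩ := Metric.eventually_nhds_iff_ball.1 h1
  refine eventually_prod_iff.2 ⟨fun z => z ∈ Metric.ball (0 : E) r, Metric.ball_mem_nhds _ hr, P₂, h2,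
    fun {z} hz {v} hv => ?_⟩
  have key : ∀ y ∈ Metric.ball (0 : E) r,
      HasFDerivAt (fun y => S.nor (π.localAct y v)) (0 : E →L[ℝ] V) y := by
    intro y hy
    obtain ⟨⟨⟨k1, k2⟩, k3⟩, k4⟩ := h12 (hball y hy) hv
    simp only at k1 k2 k3 k4
    have d1 : HasFDerivAt (fun y => π.localAct y v)
      ((ContinuousLinearMap.apply ℝ V v) ∘L fderiv ℝ π.localAct y) y :=
        (ContinuousLinearMap.apply ℝ V v).hasFDerivAt.comp y
          (k3.differentiableAt (by simp)).hasFDerivAt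
    have d2 : HasFDerivAt S.nor (fderiv ℝ S.nor (π.localAct y v)) (π.localAct y v) :=
      (k2.differentiableAt (by simp)).hasFDerivAt
    have d3 : (0 : E →L[ℝ] V) = fderiv ℝ S.nor (π.localAct y v) ∘L
        ((ContinuousLinearMap.apply ℝ V v) ∘L fderiv ℝ π.localAct y) := by
      ext x
      exact (k1 _ (k4 v x)).symm
    rw [d3]
    exact HasFDerivAt.comp (g := S.nor) y d2 d1
  have := (convex_ball (0 : E) r).is_const_of_fderivWithin_eq_zero (𝕜 := ℝ)
    (f := fun y => S.nor (π.localAct y v))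
    (fun y hy => (key y hy).differentiableAt.differentiableWithinAt)
    (fun y hy => by
      rw [fderivWithin_of_isOpen Metric.isOpen_ball hy]
      exact (key y hy).fderiv) hz (Metric.mem_ball_self hr)
  simpa using this

variable (π) in
theorem tendsto_localAct_apply (w : V) :
    Tendsto (fun z : E => π.localAct z w) (𝓝 0) (𝓝 w) := by
  have h1 : ContinuousAt π.localAct 0 :=
    π.eventually_contDiffAt_localAct.self_of_nhds.continuousAt
  have h2 := (h1.clm_apply (continuousAt_const (y := w))).tendsto
  rwa [localAct_zero] at h2

theorem eventually_nor_localAct_self (hw : π.IsRegular w) :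
    ∀ᶠ z in 𝓝 (0 : E), S.nor (π.localAct z w) = w := by
  have h := (S.eventually_nor_localAct hw).curry
  filter_upwards [h] with z hz
  have := hz.self_of_nhds
  rwa [S.nor_self] at this

/-- A local section of the orbit map at a regular point `w`: an element of `G w` which is moved out
of `w` by a group element near `1` is moved out of `w` by the group element attached to its
tangential slice coordinate. -/
theorem eventually_localAct_eq (hw : π.IsRegular w) :
    ∀ᶠ z in 𝓝 (0 : E),
      π.localAct z w = π.localAct (S.s (S.chart.symm (π.localAct z w))) w := by
  have e1 := S.eventually_nor_localAct_self hw
  have h3 := tendsto_localAct_apply π w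
  filter_upwards [e1, h3 (S.chart.open_target.mem_nhds S.mem_target)] with z h1 h2
  have h4 := S.chart.right_inv h2
  rw [S.chart_apply] at h4
  change π.norProj w (S.chart.symm (π.localAct z w)) = w at h1
  rw [h1] at h4
  exact h4.symm

end SliceChart

end OrthogonalRep

/-! ### Components of topological groups -/

section TopGroup

variable {G : Type*} [TopologicalSpace G] [Group G] [IsTopologicalGroup G]

theorem connectedComponent_eq_iff {x y : G} :
    connectedComponent x = connectedComponent y ↔
      x⁻¹ * y ∈ Subgroup.connectedComponentOfOne G := by
  have key : ∀ a b c : G, b ∈ connectedComponent c → a * b ∈ connectedComponent (a * c) :=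
    fun a b c hb => (continuous_const_mul a).image_connectedComponent_subset c ⟨b, hb, rfl⟩
  rw [connectedComponent_eq_iff_mem]
  constructor
  · intro h
    have := key y⁻¹ x y h
    rw [inv_mul_cancel] at this
    have h2 := (Subgroup.connectedComponentOfOne G).inv_mem this
    simpa using h2
  · intro h
    have h2 := inv_mem h
    have := key y _ 1 h2
    simpa using this

/-- The connected components of a topological group are the cosets of the identity component. -/
theorem card_connectedComponents :
    ENat.card (ConnectedComponents G) = ENat.card (G ⧸ Subgroup.connectedComponentOfOne G) := by
  refine ENat.card_congr (Quotient.congr (Equiv.refl G) fun a b => ?_)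
  have h1 : connectedComponentSetoid G a b ↔ connectedComponent a = connectedComponent b := Iff.rfl
  have h2 : (QuotientGroup.leftRel (Subgroup.connectedComponentOfOne G)) a b ↔
    a⁻¹ * b ∈ Subgroup.connectedComponentOfOne G := QuotientGroup.leftRel_apply
  exact h1.trans (connectedComponent_eq_iff.trans h2.symm)

/-- The identity component of a subgroup, as a subgroup of the ambient group. -/
def idComp (K : Subgroup G) : Subgroup G :=
  (Subgroup.connectedComponentOfOne K).map K.subtype

theorem idComp_le (K : Subgroup G) : idComp K ≤ K := by
  rintro _ ⟨x, -, rfl⟩; exact x.2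

theorem isPreconnected_idComp (K : Subgroup G) : IsPreconnected (idComp K : Set G) :=
  isPreconnected_connectedComponent.image _ continuous_subtype_val.continuousOn

theorem subset_idComp {K : Subgroup G} {s : Set G} (hs : IsPreconnected s) (h1 : (1 : G) ∈ s)
    (hK : s ⊆ K) : s ⊆ idComp K := by
  intro x hx
  have h2 : IsPreconnected ((Subtype.val : K → G) ⁻¹' s) := by
    refine IsInducing.subtypeVal.isPreconnected_image.1 ?_
    have e : Subtype.val '' ((Subtype.val : K → G) ⁻¹' s) = s :=
      image_preimage_eq_of_subset (by simpa using hK)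
    exact e.symm ▸ hs
  exact ⟨⟨x, hK hx⟩, h2.subset_connectedComponent (x := (1 : K)) h1 hx, rfl⟩

theorem isClosed_idComp {K : Subgroup G} (hK : IsClosed (K : Set G)) :
    IsClosed (idComp K : Set G) :=
  hK.isClosedEmbedding_subtypeVal.isClosedMap _ isClosed_connectedComponent

theorem idComp_mono {K L : Subgroup G} (h : K ≤ L) : idComp K ≤ idComp L :=
  subset_idComp (isPreconnected_idComp K) (one_mem (idComp K)) fun _ hx => h (idComp_le K hx)

theorem relIndex_idComp (K : Subgroup G) :
    (idComp K).relIndex K = (Subgroup.connectedComponentOfOne K).index := by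
  rw [idComp, Subgroup.relIndex, Subgroup.subgroupOf,
    Subgroup.comap_map_eq_self_of_injective (Subgroup.subtype_injective K)]

/-- The number of connected components of a subgroup is the index of its identity component. An
infinite index is `0` by convention and has to be excluded. -/
theorem card_connectedComponents_subgroup {K : Subgroup G} (h : (idComp K).relIndex K ≠ 0) :
    ENat.card (ConnectedComponents K) = (idComp K).relIndex K := by
  rw [relIndex_idComp] at h ⊢
  have : (Subgroup.connectedComponentOfOne K).FiniteIndex := ⟨h⟩
  rw [card_connectedComponents, Subgroup.index, ENat.card_eq_coe_natCard]

/-- A subgroup `H` of `K` which contains a neighbourhood of `1` in `K` has the same identity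
component as `K`. -/
theorem idComp_eq_of_nhds {H K : Subgroup G} (hHK : H ≤ K) {U : Set G} (hU : U ∈ 𝓝 (1 : G))
    (h : ∀ g ∈ U, g ∈ K → g ∈ H) : idComp H = idComp K := by
  refine le_antisymm (idComp_mono hHK)
    (subset_idComp (isPreconnected_idComp K) (one_mem (idComp K)) ?_)
  have ho : IsOpen ((H.subgroupOf K : Subgroup K) : Set K) := by
    refine Subgroup.isOpen_of_mem_nhds _ (g := 1) ?_
    have : (Subtype.val : K → G) ⁻¹' U ∈ 𝓝 (1 : K) :=
      continuous_subtype_val.continuousAt.preimage_mem_nhds hU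
    filter_upwards [this] with k hk
    exact h k hk k.2
  have hc : IsClopen ((H.subgroupOf K : Subgroup K) : Set K) :=
    ⟨Subgroup.isClosed_of_isOpen _ ho, ho⟩
  rintro _ ⟨x, hx, rfl⟩
  exact (isPreconnected_connectedComponent (x := (1 : K))).subset_isClopen hc
    ⟨1, mem_connectedComponent, one_mem _⟩ hx

/-- A subgroup which contains a neighbourhood of `1` in a compact group has finite index in it. -/
theorem relIndex_ne_zero_of_nhds [CompactSpace G] {H K : Subgroup G} (hK : IsClosed (K : Set G))
    {U : Set G} (hU : U ∈ 𝓝 (1 : G))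
    (h : ∀ g ∈ U, g ∈ K → g ∈ H) : H.relIndex K ≠ 0 := by
  have ho : IsOpen ((H.subgroupOf K : Subgroup K) : Set K) := by
    refine Subgroup.isOpen_of_mem_nhds _ (g := 1) ?_
    have : (Subtype.val : K → G) ⁻¹' U ∈ 𝓝 (1 : K) :=
      continuous_subtype_val.continuousAt.preimage_mem_nhds hU
    filter_upwards [this] with k hk
    exact h k hk k.2
  have : CompactSpace K := isCompact_iff_compactSpace.1 hK.isCompact
  have := Subgroup.quotient_finite_of_isOpen _ ho
  have := Subgroup.finiteIndex_of_finite_quotient (H := H.subgroupOf K)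
  exact this.index_ne_zero

theorem idComp_map_conj (K : Subgroup G) (g : G) :
    idComp (K.map (MulAut.conj g).toMonoidHom) = (idComp K).map (MulAut.conj g).toMonoidHom := by
  have key : ∀ (K : Subgroup G) (g : G),
      (idComp K).map (MulAut.conj g).toMonoidHom ≤ idComp (K.map (MulAut.conj g).toMonoidHom) := by
    intro K g
    refine subset_idComp ?_ (one_mem (Subgroup.map _ (idComp K))) (Subgroup.map_mono (idComp_le K))
    refine (isPreconnected_idComp K).image _ (Continuous.continuousOn ?_)
    change Continuous fun h : G => g * h * g⁻¹
    fun_prop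
  refine le_antisymm ?_ (key K g)
  have h := Subgroup.map_mono (f := (MulAut.conj g).toMonoidHom)
    (key (K.map (MulAut.conj g).toMonoidHom) g⁻¹)
  rw [Subgroup.map_map, Subgroup.map_map] at h
  have e1 : (MulAut.conj g).toMonoidHom.comp (MulAut.conj g⁻¹).toMonoidHom = MonoidHom.id G := by
    ext x; simp [mul_assoc]
  have e2 : (MulAut.conj g⁻¹).toMonoidHom.comp (MulAut.conj g).toMonoidHom = MonoidHom.id G := by
    ext x; simp [mul_assoc]
  rwa [e1, e2, Subgroup.map_id, Subgroup.map_id] at h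

/-- In a compact group, a conjugate of a closed subgroup `K` which is contained in `K` is equal to
`K`, since the conjugating element is inverted in the closure of its positive powers. -/
theorem map_conj_eq_of_le [CompactSpace G] {K : Subgroup G} (hK : IsClosed (K : Set G)) {g : G}
    (h : K.map (MulAut.conj g).toMonoidHom ≤ K) : K.map (MulAut.conj g).toMonoidHom = K := by
  refine le_antisymm h ?_
  let S : Set G := {a | ∀ k ∈ K, a * k * a⁻¹ ∈ K}
  have hS : IsClosed S := by
    have : S = ⋂ k ∈ K, (fun a : G => a * k * a⁻¹) ⁻¹' K := by
      ext a; simp [S]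
    rw [this]
    exact isClosed_biInter fun k _ => hK.preimage (by fun_prop)
  have hg : g ∈ S := fun k hk => h ⟨k, hk, rfl⟩
  have hpow : ∀ n : ℕ, g ^ n ∈ S := by
    intro n
    induction n with
    | zero => intro k hk; simpa using hk
    | succ n ih =>
      intro k hk
      have := ih _ (hg k hk)
      simpa [pow_succ, mul_assoc] using this
  have hinv : g⁻¹ ∈ S := by
    have h1 : MapClusterPt g⁻¹ atTop (g ^ · : ℕ → G) :=
      mapClusterPt_inv_atTop_pow.2 (mapClusterPt_self_atTop_pow g)
    have h2 := ((mapClusterPt_atTop_pow_tfae g⁻¹ g).out 0 2).1 h1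
    exact closure_minimal (range_subset_iff.2 hpow) hS h2
  intro k hk
  exact ⟨g⁻¹ * k * g, by simpa using hinv k hk, by simp [mul_assoc]⟩

end TopGroup

/-! ### Sections of polar representations -/

namespace OrthogonalRep

variable {E G V : Type*} [NormedAddCommGroup E] [NormedSpace ℝ E]
  [TopologicalSpace G] [ChartedSpace E G] [Group G]
  [NormedAddCommGroup V] [InnerProductSpace ℝ V] (π : OrthogonalRep E G V)

theorem tendsto_toHom_prod (g : G) (v : V) :
    Tendsto (fun q : G × V => π.toHom q.1 q.2) (𝓝 g ×ˢ 𝓝 v) (𝓝 (π.toHom g v)) := by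
  rw [tendsto_iff_dist_tendsto_zero]
  have h1 : Tendsto (fun q : G × V => dist q.2 v + dist (π.toHom q.1 v) (π.toHom g v))
      (𝓝 g ×ˢ 𝓝 v) (𝓝 (0 + 0)) := by
    refine Tendsto.add ?_ ?_
    · exact (tendsto_iff_dist_tendsto_zero.1 tendsto_id).comp tendsto_snd
    · exact (tendsto_iff_dist_tendsto_zero.1 ((π.continuous_toHom_apply v).tendsto g)).comp
        tendsto_fst
  rw [add_zero] at h1
  refine squeeze_zero (fun _ => dist_nonneg) (fun q => ?_) h1
  calc dist (π.toHom q.1 q.2) (π.toHom g v)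
      ≤ dist (π.toHom q.1 q.2) (π.toHom q.1 v) + dist (π.toHom q.1 v) (π.toHom g v) :=
        dist_triangle _ _ _
    _ = _ := by rw [LinearIsometryEquiv.dist_map]

/-- A section: a linear subspace which meets every orbit, and does so orthogonally. -/
structure IsSection (c : Submodule ℝ V) : Prop where
  exists_mem_orbit : ∀ v : V, ∃ u ∈ c, u ∈ π.orbit v
  inner_eq_zero : ∀ u ∈ c, ∀ x : LieAlg E G, ∀ w ∈ c, inner ℝ (π.infAct u x) w = 0

variable {π} in
theorem IsSection.exists_toHom_mem {c : Submodule ℝ V} (hc : π.IsSection c) (v : V) :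
    ∃ g : G, π.toHom g v ∈ c := by
  obtain ⟨u, hu, g, rfl⟩ := hc.exists_mem_orbit v
  exact ⟨g, hu⟩

/-- The pointwise stabilizer of a subspace. -/
def fixer (c : Submodule ℝ V) : Subgroup G := ⨅ u : c, π.isotropy u

/-- The setwise stabilizer of a subspace. -/
def stab (c : Submodule ℝ V) : Subgroup G where
  carrier := {g | ∀ u ∈ c, π.toHom g u ∈ c ∧ π.toHom g⁻¹ u ∈ c}
  one_mem' u hu := by simpa using hu
  mul_mem' {a b} ha hb u hu := by
    rw [mul_inv_rev, toHom_mul_apply, toHom_mul_apply]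
    exact ⟨(ha _ (hb u hu).1).1, (hb _ (ha u hu).2).2⟩
  inv_mem' {a} ha u hu := by
    rw [inv_inv]; exact (ha u hu).symm

theorem mem_fixer {c : Submodule ℝ V} {g : G} : g ∈ π.fixer c ↔ ∀ u ∈ c, π.toHom g u = u := by
  simp [fixer, Subgroup.mem_iInf, mem_isotropy]

theorem fixer_le_isotropy {c : Submodule ℝ V} {u : V} (hu : u ∈ c) :
    π.fixer c ≤ π.isotropy u := fun _ hg => π.mem_fixer.1 hg u hu

theorem isotropy_toHom (g : G) (v : V) :
    π.isotropy (π.toHom g v) = (π.isotropy v).map (MulAut.conj g).toMonoidHom := by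
  ext h
  constructor
  · intro hh
    refine ⟨g⁻¹ * h * g, ?_, by simp [mul_assoc]⟩
    have : π.toHom h (π.toHom g v) = π.toHom g v := hh
    change π.toHom (g⁻¹ * h * g) v = v
    simp [this]
  · rintro ⟨k, hk, rfl⟩
    have : π.toHom k v = v := hk
    change π.toHom (g * k * g⁻¹) (π.toHom g v) = π.toHom g v
    simp [this]

theorem isClosed_isotropy (v : V) : IsClosed (π.isotropy v : Set G) :=
  isClosed_eq (π.continuous_toHom_apply v) continuous_const

variable [FiniteDimensional ℝ V] [FiniteDimensional ℝ E] [LieGroup 𝓘(ℝ, E) ∞ G]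

section IsTopologicalGroup

variable [IsTopologicalGroup G]

theorem isClosed_stab (c : Submodule ℝ V) : IsClosed (π.stab c : Set G) := by
  have : (π.stab c : Set G) = ⋂ u ∈ c, ((fun g => π.toHom g u) ⁻¹' c ∩
      (fun g => π.toHom g⁻¹ u) ⁻¹' c) := by
    ext g
    simp only [mem_iInter]
    rfl
  rw [this]
  have hcl : IsClosed (c : Set V) := c.closed_of_finiteDimensional
  exact isClosed_biInter fun u _ => (hcl.preimage (π.continuous_toHom_apply u)).inter
    (hcl.preimage ((π.continuous_toHom_apply u).comp continuous_inv))

variable {π}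

theorem SliceChart.eventually_nor_toHom {w : V} (S : π.SliceChart w) (hw : π.IsRegular w) :
    ∀ᶠ q in 𝓝 (1 : G) ×ˢ 𝓝 w, S.nor (π.toHom q.1 q.2) = S.nor q.2 := by
  obtain ⟨P₁, h1, P₂, h2, h12⟩ := eventually_prod_iff.1 (S.eventually_nor_localAct hw)
  have h3 : ∀ᶠ g in 𝓝 (1 : G), ∃ z : E, P₁ z ∧ chartParam E G z = g := by
    refine nhds_one_le_map_chartParam E G (mem_map.2 ?_)
    filter_upwards [h1] with z hz
    exact ⟨z, hz, rfl⟩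
  refine eventually_prod_iff.2 ⟨_, h3, P₂, h2, ?_⟩
  rintro _ ⟨z, hz, rfl⟩ v hv
  exact h12 hz hv

/-- Identity components of isotropy groups of regular points are open in them: near `1` the
isotropy group is a retract of `G`. -/
theorem isOpen_connectedComponentOfOne {w : V} (hw : π.IsRegular w) :
    IsOpen (Subgroup.connectedComponentOfOne (π.isotropy w) : Set (π.isotropy w)) := by
  obtain ⟨S⟩ := π.nonempty_sliceChart w
  have hψ : ∀ᶠ z in 𝓝 (0 : E), ContinuousAt (chartParam E G) z :=
    (eventually_contMDiffAt_chartParam E G).mono fun z hz => hz.continuousAt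
  have hτ : ∀ᶠ z in 𝓝 (0 : E), ContinuousAt π.localAct z :=
    π.eventually_contDiffAt_localAct.mono fun z hz => hz.continuousAt
  have ht := SliceChart.tendsto_localAct_apply π w
  have hs := ht.eventually (S.chart.open_target.mem_nhds S.mem_target)
  have hψ' := ((S.tendsto_s.comp S.tendsto_symm).comp ht).eventually hψ
  obtain ⟨ρ, hρ, hball⟩ := Metric.eventually_nhds_iff_ball.1
    ((((S.eventually_localAct_eq hw).and hψ).and hτ).and (hs.and hψ'))
  set σ : E → G := fun z => chartParam E G (S.s (S.chart.symm (π.localAct z w))) with hσ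
  let r : E → G := fun z => (σ z)⁻¹ * chartParam E G z
  have hr : ∀ z ∈ Metric.ball (0 : E) ρ, r z ∈ π.isotropy w := by
    intro z hz
    have h1 := (hball z hz).1.1.1
    change π.toHom ((σ z)⁻¹ * chartParam E G z) w = w
    rw [toHom_mul_apply]
    change π.toHom (σ z)⁻¹ (π.localAct z w) = w
    rw [h1]
    exact π.toHom_inv_toHom _ _
  have hrc : ContinuousOn r (Metric.ball (0 : E) ρ) := by
    intro z hz
    obtain ⟨⟨⟨-, h2⟩, h3⟩, h4, h5⟩ := hball z hz
    refine ContinuousAt.continuousWithinAt ?_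
    have h6 : ContinuousAt (fun z => π.localAct z w) z := h3.clm_apply continuousAt_const
    have h7 : ContinuousAt (fun z => S.s (S.chart.symm (π.localAct z w))) z :=
      S.s.continuous.continuousAt.comp
        (ContinuousAt.comp (f := fun z => π.localAct z w) (S.chart.continuousAt_symm h4) h6)
    have h8 : ContinuousAt σ z :=
      ContinuousAt.comp (f := fun z => S.s (S.chart.symm (π.localAct z w))) h5 h7
    exact h8.inv.mul h2
  have hpre : IsPreconnected (r '' Metric.ball (0 : E) ρ) :=
    (convex_ball (0 : E) ρ).isPreconnected.image r hrc
  have hfix : ∀ z, π.localAct z w = w → r z = chartParam E G z := by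
    intro z hz
    simp [r, hσ, hz]
  have h0 : r 0 = 1 := by
    rw [hfix 0 (by simp)]; simp
  have hsub := subset_idComp (K := π.isotropy w) hpre
    ⟨0, Metric.mem_ball_self hρ, h0⟩ (by rintro _ ⟨z, hz, rfl⟩; exact hr z hz)
  have hU : ∀ᶠ g in 𝓝 (1 : G), ∃ z ∈ Metric.ball (0 : E) ρ, chartParam E G z = g := by
    refine nhds_one_le_map_chartParam E G (mem_map.2 ?_)
    filter_upwards [Metric.ball_mem_nhds (0 : E) hρ] with z hz
    exact ⟨z, hz, rfl⟩
  refine Subgroup.isOpen_of_mem_nhds _ (g := 1) ?_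
  have hc : Tendsto (Subtype.val : π.isotropy w → G) (𝓝 1) (𝓝 1) :=
    continuous_subtype_val.tendsto (1 : π.isotropy w)
  filter_upwards [hc.eventually hU] with k hk
  obtain ⟨z, hz, hzk⟩ := hk
  have hzw : π.localAct z w = w := by
    rw [localAct_apply, hzk]; exact k.2
  obtain ⟨k', hk', hkk⟩ := hsub ⟨z, hz, (hfix z hzw).trans hzk⟩
  have : k' = k := Subtype.ext hkk
  rwa [← this]

variable [CompactSpace G]

theorem relIndex_idComp_isotropy_ne_zero {w : V} (hw : π.IsRegular w) :
    (idComp (π.isotropy w)).relIndex (π.isotropy w) ≠ 0 := by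
  rw [relIndex_idComp]
  have : CompactSpace (π.isotropy w) := isCompact_iff_compactSpace.1 (π.isClosed_isotropy w).isCompact
  have := Subgroup.quotient_finite_of_isOpen _ (isOpen_connectedComponentOfOne hw)
  have := Subgroup.finiteIndex_of_finite_quotient
    (H := Subgroup.connectedComponentOfOne (π.isotropy w))
  exact this.index_ne_zero

namespace IsSection

variable {c : Submodule ℝ V} (hc : π.IsSection c)
include hc

theorem le_tan_orthogonal {u : V} (hu : u ∈ c) : c ≤ (π.tan u)ᗮ := by
  intro w hw
  rw [Submodule.mem_orthogonal]
  rintro _ ⟨x, rfl⟩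
  exact hc.inner_eq_zero u hu x w hw

/-- A section is the full normal space at its regular points: the normal space near such a point is
covered by finitely many Lipschitz images of the section, which bounds its dimension. -/
theorem tan_orthogonal_eq {w : V} (hw : π.IsRegular w) (hwc : w ∈ c) : (π.tan w)ᗮ = c := by
  refine (Submodule.eq_of_le_of_finrank_le (hc.le_tan_orthogonal hwc) ?_).symm
  obtain ⟨S⟩ := π.nonempty_sliceChart w
  obtain ⟨K, t, ht, hLip⟩ := S.contDiffAt_nor.exists_lipschitzOnWith
  have hinv : Tendsto (fun q : G × V => π.toHom q.1⁻¹ q.2) (𝓝 1 ×ˢ 𝓝 w) (𝓝 w) := by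
    have h1 := π.tendsto_toHom_prod 1 w
    rw [toHom_one_apply] at h1
    have h2 : Tendsto (fun q : G × V => (q.1⁻¹, q.2)) (𝓝 1 ×ˢ 𝓝 w) (𝓝 1 ×ˢ 𝓝 w) := by
      refine Tendsto.prodMk ?_ tendsto_snd
      have := (continuous_inv (G := G)).tendsto 1
      rw [inv_one] at this
      exact this.comp tendsto_fst
    exact h1.comp h2
  have hinv2 : Tendsto (fun q : G × V => (q.1, π.toHom q.1⁻¹ q.2)) (𝓝 1 ×ˢ 𝓝 w)
      (𝓝 1 ×ˢ 𝓝 w) := tendsto_fst.prodMk hinv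
  have hev := (hinv2.eventually (S.eventually_nor_toHom hw)).and (hinv.eventually ht)
  obtain ⟨P₁, h1, P₂, h2, h12⟩ := eventually_prod_iff.1 hev
  obtain ⟨F, -, hF⟩ := isCompact_univ.elim_nhds_subcover (fun f : G => {k | P₁ (k * f⁻¹)})
    (fun f _ => by
      have h3 : Tendsto (fun k : G => k * f⁻¹) (𝓝 f) (𝓝 1) := by
        have := (continuous_mul_const f⁻¹ : Continuous fun k : G => k * f⁻¹).tendsto f
        rwa [mul_inv_cancel] at this
      exact h3 h1)
  -- the Lipschitz images of the section, one for each of the finitely many translations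
  let A : G → Set V := fun f => (fun a : c => S.nor (π.toHom f a)) '' {a | π.toHom f a ∈ t}
  have hA : ∀ f, dimH (A f) ≤ finrank ℝ c := by
    intro f
    have hl : LipschitzOnWith (K * 1) (fun a : c => S.nor (π.toHom f a)) {a | π.toHom f a ∈ t} := by
      refine hLip.comp (g := S.nor) (f := fun a : c => π.toHom f a) ?_ (fun a ha => ha)
      exact ((π.toHom f).isometry.comp isometry_subtype_coe).lipschitz.lipschitzOnWith
    calc dimH (A f) ≤ dimH {a : c | π.toHom f a ∈ t} := hl.dimH_image_le
      _ ≤ dimH (univ : Set c) := dimH_mono (subset_univ _)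
      _ = finrank ℝ c := Real.dimH_univ_eq_finrank c
  let D : Set (π.tan w)ᗮ := {y | P₂ (y : V) ∧ S.nor y = y}
  have hD : D ∈ 𝓝 (⟨w, π.self_mem_tan_orthogonal w⟩ : (π.tan w)ᗮ) := by
    have hcs : Tendsto (Subtype.val : (π.tan w)ᗮ → V)
        (𝓝 ⟨w, π.self_mem_tan_orthogonal w⟩) (𝓝 w) := continuous_subtype_val.tendsto _
    filter_upwards [hcs.eventually h2, hcs.eventually S.eventually_nor_of_normal] with y hy1 hy2
    exact ⟨hy1, hy2 y.2⟩
  have hsub : (Subtype.val '' D : Set V) ⊆ ⋃ f ∈ (F : Set G), A f := by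
    rintro _ ⟨y, ⟨hy1, hy2⟩, rfl⟩
    obtain ⟨g, hg⟩ := hc.exists_toHom_mem (y : V)
    obtain ⟨f, hf, hgf⟩ := mem_iUnion₂.1 (hF (mem_univ g⁻¹))
    refine mem_iUnion₂.2 ⟨f, hf, ⟨_, hg⟩, ?_, ?_⟩
    · have h3 : π.toHom (g⁻¹ * f⁻¹)⁻¹ y ∈ t := (h12 hgf hy1).2
      simpa using h3
    · have h3 := (h12 hgf hy1).1
      simp only [toHom_toHom_inv] at h3
      rw [hy2] at h3
      simpa using h3.symm
  have hfin : dimH (Subtype.val '' D : Set V) = finrank ℝ (π.tan w)ᗮ := by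
    rw [isometry_subtype_coe.dimH_image]
    exact Real.dimH_of_mem_nhds hD
  have hle : dimH (Subtype.val '' D : Set V) ≤ finrank ℝ c := by
    refine (dimH_mono hsub).trans ?_
    rw [dimH_bUnion F.countable_toSet]
    exact iSup₂_le fun f _ => hA f
  rw [hfin] at hle
  exact_mod_cast hle

theorem tan_eq {w : V} (hw : π.IsRegular w) (hwc : w ∈ c) : π.tan w = cᗮ := by
  rw [← hc.tan_orthogonal_eq hw hwc, Submodule.orthogonal_orthogonal]

/-- The isotropy algebra of a regular point of a section annihilates the section. For a regular
`w ∈ c` and `u ∈ c`, if `x · w = 0`, the function `h ↦ ⟨h u, x · (h w)⟩` vanishes identically on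
`G`; its derivative at `1` in the direction `y` is `-⟨x · u, y · w⟩`. -/
theorem infCLM_eq_zero {w u : V} (hw : π.IsRegular w) (hwc : w ∈ c) (huc : u ∈ c) {x : E}
    (hx : π.infCLM w x = 0) : π.infCLM u x = 0 := by
  let X : V →L[ℝ] V := LinearMap.toContinuousLinearMap (π.infAct.flip x)
  have hX : ∀ v, X v = π.infCLM v x := fun v => rfl
  have h0 : ∀ h : G, inner ℝ (π.toHom h u) (X (π.toHom h w)) = 0 := by
    intro h
    have h1 : π.toHom h⁻¹ (X (π.toHom h w)) ∈ π.tan w := by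
      have h2 : X (π.toHom h w) ∈ π.tan (π.toHom h w) := π.infCLM_mem_tan _ x
      have h3 := π.toHom_mem_tan (g := h⁻¹) h2
      rwa [toHom_inv_toHom] at h3
    have h4 := (Submodule.mem_orthogonal' _ _).1 (hc.le_tan_orthogonal hwc huc) _ h1
    rw [← (π.toHom h).inner_map_map, toHom_toHom_inv] at h4
    exact h4
  have hd : ∀ v : V, HasFDerivAt (fun y => π.localAct y v) (π.infCLM v) 0 := fun v =>
    hasFDerivAt_comp_chartParam
      (((π.smooth v).contMDiffAt (x := (1 : G))).mdifferentiableAt (by simp))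
  have h1 := (hd u).inner ℝ (X.hasFDerivAt.comp (0 : E) (hd w))
  have h2 : (fun t : E => inner ℝ (π.localAct t u) ((X ∘ fun y => π.localAct y w) t))
      = fun _ => (0 : ℝ) := funext fun t => h0 (chartParam E G t)
  rw [h2] at h1
  have h3 := h1.unique (hasFDerivAt_const (0 : ℝ) (0 : E))
  have h4 : ∀ y : E, inner ℝ (π.infCLM u x) (π.infCLM w y) = 0 := by
    intro y
    have h5 := congrArg (fun T : E →L[ℝ] ℝ => T y) h3
    simp only [localAct_zero, ContinuousLinearMap.id_apply] at h5
    have h6 : inner ℝ u (X (π.infCLM w y)) +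
        inner ℝ (π.infCLM u y) (X (π.localAct 0 w)) = 0 := h5
    rw [localAct_zero, ContinuousLinearMap.id_apply, hX w, hx, inner_zero_right, add_zero, hX] at h6
    rw [π.inner_infCLM_left, h6, neg_zero]
  have h5 : π.infCLM u x ∈ (π.tan w)ᗮ := by
    rw [Submodule.mem_orthogonal']
    rintro _ ⟨y, rfl⟩
    exact h4 y
  rw [hc.tan_orthogonal_eq hw hwc] at h5
  have h6 := (Submodule.mem_orthogonal' _ _).1 (hc.le_tan_orthogonal huc h5) _
    (π.infCLM_mem_tan u x)
  exact inner_self_eq_zero.1 h6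

theorem isotropy_le_stab {v : V} (hv : π.IsRegular v) (hvc : v ∈ c) : π.isotropy v ≤ π.stab c := by
  have key : ∀ g ∈ π.isotropy v, ∀ u ∈ c, π.toHom g u ∈ c := by
    intro g hg u hu
    rw [← hc.tan_orthogonal_eq hv hvc] at hu ⊢
    rw [Submodule.mem_orthogonal] at hu ⊢
    intro t ht
    have hgi : π.toHom g⁻¹ v = v := inv_mem hg
    have h1 := π.toHom_mem_tan (g := g⁻¹) ht
    rw [hgi] at h1
    have h2 := hu _ h1
    rwa [← (π.toHom g).inner_map_map, toHom_toHom_inv] at h2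
  exact fun g hg u hu => ⟨key g hg u hu, key g⁻¹ (inv_mem hg) u hu⟩

theorem exists_isRegular_mem : ∃ w ∈ c, π.IsRegular w := by
  obtain ⟨v, hv⟩ := π.exists_isRegular
  obtain ⟨g, hg⟩ := hc.exists_toHom_mem v
  exact ⟨_, hg, π.isRegular_toHom.2 hv⟩

/-- Elements of `G` near `1` which preserve a section fix it pointwise. -/
theorem eventually_mem_fixer : ∀ᶠ g in 𝓝 (1 : G), g ∈ π.stab c → g ∈ π.fixer c := by
  obtain ⟨w, hwc, hw⟩ := hc.exists_isRegular_mem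
  obtain ⟨S⟩ := π.nonempty_sliceChart w
  have hcn := hc.tan_orthogonal_eq hw hwc
  have h1 := π.tendsto_toHom_prod 1 w
  rw [toHom_one_apply] at h1
  have hn := S.eventually_nor_of_normal
  rw [hcn] at hn
  have hev := ((S.eventually_nor_toHom hw).and (h1.eventually hn)).and (tendsto_snd.eventually hn)
  obtain ⟨P₁, hP₁, P₂, hP₂, h12⟩ := eventually_prod_iff.1 hev
  filter_upwards [hP₁] with g hg hgs
  have key : ∀ y ∈ c, P₂ y → π.toHom g y = y := by
    intro y hy hy2
    obtain ⟨⟨k1, k2⟩, k3⟩ := h12 hg hy2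
    simp only at k1 k2 k3
    rw [← k2 (hgs y hy).1, k1, k3 hy]
  rw [mem_fixer]
  intro u hu
  have hgw := key w hwc hP₂.self_of_nhds
  have ht : Tendsto (fun t : ℝ => w + t • u) (𝓝 0) (𝓝 w) := by
    have : Continuous fun t : ℝ => w + t • u := by fun_prop
    simpa using this.tendsto 0
  have ht2 : ∀ᶠ t in 𝓝[≠] (0 : ℝ), P₂ (w + t • u) ∧ t ≠ 0 :=
    ((ht.eventually hP₂).filter_mono nhdsWithin_le_nhds).and eventually_mem_nhdsWithin
  obtain ⟨t, ht3, ht4⟩ := ht2.exists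
  have h5 := key _ (c.add_mem hwc (c.smul_mem t hu)) ht3
  rw [map_add, map_smul, hgw] at h5
  exact smul_right_injective V ht4 (add_left_cancel h5)

theorem fixer_relIndex_stab_ne_zero : (π.fixer c).relIndex (π.stab c) ≠ 0 :=
  relIndex_ne_zero_of_nhds (π.isClosed_stab c) hc.eventually_mem_fixer fun _ hg => hg

theorem fixer_relIndex_isotropy_ne_zero {v : V} (hv : π.IsRegular v) (hvc : v ∈ c) :
    (π.fixer c).relIndex (π.isotropy v) ≠ 0 :=
  relIndex_ne_zero_of_nhds (π.isClosed_isotropy v) hc.eventually_mem_fixer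
    fun _ hg h => hg (hc.isotropy_le_stab hv hvc h)

/-- A generic point of a section is fixed only by the pointwise stabilizer of the section, because
the elements preserving the section induce finitely many transformations of it. -/
theorem exists_isotropy_eq_fixer : ∃ w ∈ c, π.IsRegular w ∧ π.isotropy w = π.fixer c := by
  obtain ⟨w₁, hw₁c, hw₁⟩ := hc.exists_isRegular_mem
  -- the proper fixed-point subspaces of the section
  let Fix : G → Submodule ℝ c := fun g =>
    LinearMap.ker (((π.toHom g).toLinearEquiv.toLinearMap - LinearMap.id) ∘ₗ c.subtype)
  have hFix : ∀ g (u : c), u ∈ Fix g ↔ π.toHom g u = u := by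
    intro g u
    simp only [Fix, LinearMap.mem_ker, LinearMap.comp_apply, LinearMap.sub_apply,
      LinearMap.id_apply, sub_eq_zero]
    rfl
  have hfin : (Fix '' (π.stab c : Set G)).Finite := by
    have : ((π.fixer c).subgroupOf (π.stab c)).FiniteIndex := ⟨hc.fixer_relIndex_stab_ne_zero⟩
    have hq : Finite (π.stab c ⧸ (π.fixer c).subgroupOf (π.stab c)) := inferInstance
    let q : (π.stab c ⧸ (π.fixer c).subgroupOf (π.stab c)) → Submodule ℝ c :=
      Quotient.lift (fun g : π.stab c => Fix (g : G)) (by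
        intro a b hab
        have hab' : (a : G)⁻¹ * b ∈ π.fixer c :=
          Subgroup.mem_subgroupOf.1 (QuotientGroup.leftRel_apply.1 hab)
        have hb : ∀ u : c, π.toHom (b : G) u = π.toHom (a : G) u := fun u => by
          have := π.mem_fixer.1 hab' u u.2
          rw [toHom_mul_apply] at this
          rw [← this, toHom_toHom_inv, this]
        ext u
        rw [hFix, hFix, hb])
    refine (finite_range q).subset ?_
    rintro _ ⟨g, hg, rfl⟩
    exact ⟨QuotientGroup.mk ⟨g, hg⟩, rfl⟩
  classical
  let 𝒮 : Finset (Submodule ℝ c) := hfin.toFinset.filter (· ≠ ⊤)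
  obtain ⟨e, he⟩ : ∃ e : c, ∀ p ∈ 𝒮, e ∉ p := by
    have h := Subspace.biUnion_ne_univ_of_top_notMem (s := 𝒮) (by simp [𝒮])
    obtain ⟨e, he⟩ := (ne_univ_iff_exists_notMem _).1 h
    exact ⟨e, fun p hp hep => he (mem_iUnion₂.2 ⟨p, hp, hep⟩)⟩
  -- a line through a regular point in a direction avoiding all the proper fixed-point subspaces
  let γ : ℝ → c := fun t => ⟨w₁, hw₁c⟩ + t • e
  have hbad : {t : ℝ | ∃ p ∈ 𝒮, γ t ∈ p}.Finite := by
    have : {t : ℝ | ∃ p ∈ 𝒮, γ t ∈ p} = ⋃ p ∈ 𝒮, {t | γ t ∈ p} := by ext; simp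
    rw [this]
    refine 𝒮.finite_toSet.biUnion fun p hp => Set.Subsingleton.finite fun t ht t' ht' => ?_
    by_contra hne
    refine he p hp ?_
    have h1 := p.sub_mem ht ht'
    have h2 : γ t - γ t' = (t - t') • e := by simp only [γ]; module
    rw [h2] at h1
    exact (p.smul_mem_iff (sub_ne_zero.2 hne)).1 h1
  obtain ⟨S⟩ := π.nonempty_sliceChart w₁
  have hreg : ∀ᶠ t in 𝓝 (0 : ℝ), π.IsRegular (γ t : V) := by
    have ht : Tendsto (fun t : ℝ => (γ t : V)) (𝓝 0) (𝓝 w₁) := by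
      have : Continuous fun t : ℝ => w₁ + t • (e : V) := by fun_prop
      simpa [γ] using this.tendsto 0
    exact ht.eventually ((S.eventually_isRegular_and_fderiv_nor_eq_zero hw₁).mono fun _ h => h.1)
  obtain ⟨t, ht, htbad⟩ : ∃ t, π.IsRegular (γ t : V) ∧ t ∉ {t : ℝ | ∃ p ∈ 𝒮, γ t ∈ p} :=
    ((infinite_of_mem_nhds (0 : ℝ) hreg).sdiff hbad).nonempty
  refine ⟨γ t, (γ t).2, ht, le_antisymm (fun g hg => ?_) (π.fixer_le_isotropy (γ t).2)⟩
  by_contra hgf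
  refine htbad ⟨Fix g, ?_, (hFix g _).2 hg⟩
  refine Finset.mem_filter.2
    ⟨hfin.mem_toFinset.2 ⟨g, hc.isotropy_le_stab ht (γ t).2 hg, rfl⟩, fun htop => hgf ?_⟩
  rw [mem_fixer]
  intro u hu
  exact (hFix g ⟨u, hu⟩).1 (htop ▸ Submodule.mem_top)

end IsSection

end IsTopologicalGroup

end OrthogonalRep

/-! ### The covering index -/

namespace OrthogonalRep

variable {E G V : Type*} [NormedAddCommGroup E] [NormedSpace ℝ E]
  [TopologicalSpace G] [ChartedSpace E G] [Group G]
  [NormedAddCommGroup V] [InnerProductSpace ℝ V] {π : OrthogonalRep E G V}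
  [FiniteDimensional ℝ V] [FiniteDimensional ℝ E] [LieGroup 𝓘(ℝ, E) ∞ G]
  [IsTopologicalGroup G] [CompactSpace G]

variable (π) in
/-- The number of connected components of the isotropy group `G_v`, for regular `v`. -/
def numComp (v : V) : ℕ := (idComp (π.isotropy v)).relIndex (π.isotropy v)

theorem numComp_pos {v : V} (hv : π.IsRegular v) : 0 < π.numComp v :=
  Nat.pos_of_ne_zero (relIndex_idComp_isotropy_ne_zero hv)

theorem numComp_toHom (g : G) (v : V) : π.numComp (π.toHom g v) = π.numComp v := by
  rw [numComp, isotropy_toHom, idComp_map_conj]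
  exact Subgroup.relIndex_map_map_of_injective _ _ (MulAut.conj g).injective

theorem isPrincipal_iff {v : V} :
    π.IsPrincipal v ↔ π.IsRegular v ∧ ∀ w, π.IsRegular w → π.numComp v ≤ π.numComp w := by
  refine and_congr_right fun hv => forall₂_congr fun w hw => ?_
  rw [card_connectedComponents_subgroup (relIndex_idComp_isotropy_ne_zero hv),
    card_connectedComponents_subgroup (relIndex_idComp_isotropy_ne_zero hw), Nat.cast_le]
  rfl

theorem IsPrincipal.toHom {v : V} (hv : π.IsPrincipal v) (g : G) :
    π.IsPrincipal (π.toHom g v) := by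
  rw [isPrincipal_iff] at hv ⊢
  rw [isRegular_toHom, numComp_toHom]
  exact hv

theorem coveringIndex_toHom (g : G) (v : V) :
    π.coveringIndex (π.toHom g v) = π.coveringIndex v := by
  have key : ∀ (g : G) (v : V) (k : ℕ),
      (∃ u : V, π.IsPrincipal u ∧ π.isotropy u ≤ π.isotropy v ∧
        k = (π.isotropy u).relIndex (π.isotropy v)) →
      ∃ u : V, π.IsPrincipal u ∧ π.isotropy u ≤ π.isotropy (π.toHom g v) ∧
        k = (π.isotropy u).relIndex (π.isotropy (π.toHom g v)) := by
    rintro g v k ⟨u, hu, hle, rfl⟩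
    refine ⟨π.toHom g u, hu.toHom g, ?_, ?_⟩
    · rw [isotropy_toHom, isotropy_toHom]; exact Subgroup.map_mono hle
    · rw [isotropy_toHom, isotropy_toHom]
      exact (Subgroup.relIndex_map_map_of_injective _ _ (MulAut.conj g).injective).symm
  unfold coveringIndex
  congr 1
  ext k
  refine ⟨fun h => ?_, key g v k⟩
  have h2 := key g⁻¹ _ k h
  simp only [toHom_inv_toHom] at h2
  exact h2

namespace IsSection

variable {c : Submodule ℝ V} (hc : π.IsSection c)
include hc

theorem idComp_isotropy {v : V} (hv : π.IsRegular v) (hvc : v ∈ c) :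
    idComp (π.isotropy v) = idComp (π.fixer c) :=
  (idComp_eq_of_nhds (π.fixer_le_isotropy hvc) hc.eventually_mem_fixer
    fun _ hg h => hg (hc.isotropy_le_stab hv hvc h)).symm

theorem numComp_eq {v : V} (hv : π.IsRegular v) (hvc : v ∈ c) :
    π.numComp v = (idComp (π.fixer c)).relIndex (π.fixer c) *
      (π.fixer c).relIndex (π.isotropy v) := by
  rw [numComp, hc.idComp_isotropy hv hvc,
    Subgroup.relIndex_mul_relIndex _ _ _ (idComp_le _) (π.fixer_le_isotropy hvc)]

theorem numComp_fixer_le {v : V} (hv : π.IsRegular v) :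
    (idComp (π.fixer c)).relIndex (π.fixer c) ≤ π.numComp v := by
  obtain ⟨g, hg⟩ := hc.exists_toHom_mem v
  have hv' := π.isRegular_toHom (g := g).2 hv
  rw [← numComp_toHom g v, hc.numComp_eq hv' hg]
  exact Nat.le_mul_of_pos_right _ (Nat.pos_of_ne_zero (hc.fixer_relIndex_isotropy_ne_zero hv' hg))

/-- For regular `v` in a section, the principal isotropy groups contained in `G_v` are conjugate to
the pointwise stabilizer of the section and have the same identity component and number of
components, so they all have the same index in `G_v`. -/
theorem coveringIndex_eq {v : V} (hv : π.IsRegular v) (hvc : v ∈ c) :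
    π.coveringIndex v = (π.fixer c).relIndex (π.isotropy v) := by
  obtain ⟨w, hwc, hw, hwH⟩ := hc.exists_isotropy_eq_fixer
  have hnw : π.numComp w = (idComp (π.fixer c)).relIndex (π.fixer c) := by rw [numComp, hwH]
  have hwp : π.IsPrincipal w := isPrincipal_iff.2 ⟨hw, fun u hu => by
    rw [hnw]; exact hc.numComp_fixer_le hu⟩
  have hset : {k | ∃ u : V, π.IsPrincipal u ∧ π.isotropy u ≤ π.isotropy v ∧
      k = (π.isotropy u).relIndex (π.isotropy v)} = {(π.fixer c).relIndex (π.isotropy v)} := by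
    ext k
    simp only [mem_ofPred_eq, mem_singleton_iff]
    constructor
    · rintro ⟨u, hu, hle, rfl⟩
      have hureg := hu.1
      have hnu : π.numComp u = (idComp (π.fixer c)).relIndex (π.fixer c) :=
        le_antisymm (hnw ▸ (isPrincipal_iff.1 hu).2 w hw) (hc.numComp_fixer_le hureg)
      obtain ⟨g, hg⟩ := hc.exists_toHom_mem u
      have hconj : idComp (π.isotropy u) =
          (idComp (π.fixer c)).map (MulAut.conj g⁻¹).toMonoidHom := by
        rw [← hc.idComp_isotropy (π.isRegular_toHom.2 hureg) hg, ← idComp_map_conj,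
          ← isotropy_toHom, toHom_inv_toHom]
      have hcl : IsClosed (idComp (π.fixer c) : Set G) := by
        rw [← hwH]
        exact isClosed_idComp (π.isClosed_isotropy w)
      have hid : idComp (π.isotropy u) = idComp (π.fixer c) := by
        rw [hconj]
        refine map_conj_eq_of_le hcl ?_
        rw [← hconj, ← hc.idComp_isotropy hv hvc]
        exact idComp_mono hle
      have h1 := Subgroup.relIndex_mul_relIndex _ _ _ (idComp_le (π.isotropy u)) hle
      have h2 : (idComp (π.isotropy u)).relIndex (π.isotropy v) = π.numComp v := by
        rw [hid, numComp, hc.idComp_isotropy hv hvc]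
      have h3 : (idComp (π.isotropy u)).relIndex (π.isotropy u) = π.numComp u := rfl
      rw [h2, h3, hc.numComp_eq hv hvc, hnu] at h1
      exact Nat.eq_of_mul_eq_mul_left (hnu ▸ numComp_pos hureg) h1
    · rintro rfl
      exact ⟨w, hwp, hwH ▸ π.fixer_le_isotropy hvc, by rw [hwH]⟩
  rw [coveringIndex, hset, csInf_singleton]

end IsSection

end OrthogonalRep

/-! ### Areas of nearly linear images -/

section Area

variable {V : Type*} [NormedAddCommGroup V] [InnerProductSpace ℝ V] [FiniteDimensional ℝ V]
  [MeasurableSpace V] [BorelSpace V]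

theorem euclideanHausdorffMeasure_image_le {X Y : Type*} [EMetricSpace X] [EMetricSpace Y]
    [MeasurableSpace X] [BorelSpace X] [MeasurableSpace Y] [BorelSpace Y] {K : ℝ≥0} {f : X → Y}
    {s : Set X} (h : LipschitzOnWith K f s) (d : ℕ) :
    μHE[d] (f '' s) ≤ (K : ℝ≥0∞) ^ d * μHE[d] s := by
  rw [Measure.euclideanHausdorffMeasure_def, Measure.euclideanHausdorffMeasure_def,
    Measure.smul_apply, Measure.smul_apply, mul_smul_comm]
  have := h.hausdorffMeasure_image_le (d := (d : ℝ)) (Nat.cast_nonneg d)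
  rw [ENNReal.rpow_natCast] at this
  gcongr

theorem image_projection_le (T : Submodule ℝ V) (s : Set V) (d : ℕ) :
    μHE[d] (T.orthogonalProjectionOnto '' s) ≤ μHE[d] s := by
  have h : LipschitzOnWith 1 T.orthogonalProjectionOnto s := by
    refine LipschitzWith.lipschitzOnWith (LipschitzWith.of_dist_le_mul fun x y => ?_)
    rw [dist_eq_norm, dist_eq_norm, ← map_sub, NNReal.coe_one, one_mul]
    exact T.norm_orthogonalProjectionOnto_apply_le _
  simpa using euclideanHausdorffMeasure_image_le h d

/-- The area formula to first order: a map `T → V` whose derivative at `0` is an automorphism `A` of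
the subspace `T` distorts `dim T`-dimensional volumes near `0` by a factor close to `|det A|`. After
orthogonal projection to `T` this is a statement about Haar measure; the projection is `1`-Lipschitz,
and its inverse on the image of `α` is Lipschitz with a constant close to `1`. -/
theorem exists_nhds_measure_image_bounds {T : Submodule ℝ V} (A : T ≃L[ℝ] T) {α : T → V}
    (hα : HasStrictFDerivAt α (T.subtypeL ∘L (A : T →L[ℝ] T)) 0) {a b : ℝ≥0}
    (ha : (a : ℝ≥0∞) < ENNReal.ofReal |(A : T →L[ℝ] T).det|)
    (hb : ENNReal.ofReal |(A : T →L[ℝ] T).det| < b) :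
    ∃ U ∈ 𝓝 (0 : T), InjOn α U ∧ ContinuousOn α U ∧ ∀ S ⊆ U,
      a * μHE[finrank ℝ T] S ≤ μHE[finrank ℝ T] (α '' S) ∧
      μHE[finrank ℝ T] (α '' S) ≤ b * μHE[finrank ℝ T] S := by
  obtain ⟨b', hb', hbb⟩ := ENNReal.lt_iff_exists_nnreal_btwn.1 hb
  have hbb' : b' < b := by exact_mod_cast hbb
  -- a Lipschitz constant close to `1` which is absorbed by `b' < b`
  obtain ⟨K, hK1, hKb⟩ : ∃ K : ℝ≥0, 1 < K ∧ K ^ finrank ℝ T * b' ≤ b := by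
    have h1 : Tendsto (fun K : ℝ≥0 => K ^ finrank ℝ T * b') (𝓝[>] 1) (𝓝 (1 ^ finrank ℝ T * b')) := by
      have : Continuous fun K : ℝ≥0 => K ^ finrank ℝ T * b' := by fun_prop
      exact (this.tendsto 1).mono_left nhdsWithin_le_nhds
    rw [one_pow, one_mul] at h1
    have h2 := (h1.eventually (gt_mem_nhds hbb')).and (self_mem_nhdsWithin (s := Ioi (1 : ℝ≥0)))
    obtain ⟨K, hK, hK1⟩ := h2.exists
    exact ⟨K, hK1, hK.le⟩
  obtain ⟨κ, hκ, hAκ⟩ : ∃ κ : ℝ, 0 < κ ∧ ∀ x : T, κ * ‖x‖ ≤ ‖A x‖ := by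
    refine ⟨(‖(A.symm : T →L[ℝ] T)‖ + 1)⁻¹, by positivity, fun x => ?_⟩
    rw [inv_mul_le_iff₀ (by positivity)]
    calc ‖x‖ = ‖(A.symm : T →L[ℝ] T) (A x)‖ := by simp
      _ ≤ ‖(A.symm : T →L[ℝ] T)‖ * ‖A x‖ := ContinuousLinearMap.le_opNorm _ _
      _ ≤ _ := by gcongr; linarith
  have e1 := addHaar_image_le_mul_of_det_lt (μHE[finrank ℝ T] : Measure T) (A : T →L[ℝ] T) hb'
  have e2 := mul_le_addHaar_image_of_lt_det (μHE[finrank ℝ T] : Measure T) (A : T →L[ℝ] T) ha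
  have e3 : ∀ᶠ δ : ℝ≥0 in 𝓝[>] 0, (δ : ℝ) < κ ∧ (δ : ℝ) < (K - 1) * (κ - δ) := by
    have h1 : Tendsto (fun δ : ℝ≥0 => (δ : ℝ)) (𝓝[>] 0) (𝓝 0) := by
      have := NNReal.continuous_coe.tendsto 0
      exact this.mono_left nhdsWithin_le_nhds
    have h2 : Tendsto (fun δ : ℝ≥0 => (K - 1) * (κ - δ) - (δ : ℝ)) (𝓝[>] 0)
        (𝓝 ((K - 1) * (κ - 0) - 0)) := ((tendsto_const_nhds.sub h1).const_mul _).sub h1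
    have hK1' : (1 : ℝ) < K := by exact_mod_cast hK1
    have h3 : 0 < ((K : ℝ) - 1) * (κ - 0) - 0 := by
      rw [sub_zero, sub_zero]; exact mul_pos (by linarith) hκ
    filter_upwards [h1.eventually (gt_mem_nhds hκ), h2.eventually (lt_mem_nhds h3)] with δ k1 k2
    exact ⟨k1, by linarith⟩
  obtain ⟨δ, ⟨⟨⟨h1, h2⟩, h3, h4⟩, hδ⟩⟩ :=
    (((e1.and e2).and e3).and (self_mem_nhdsWithin (s := Ioi (0 : ℝ≥0)))).exists
  obtain ⟨U, hU, happ⟩ := hα.approximates_deriv_on_nhds (c := δ) (Or.inr hδ)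
  let P := T.orthogonalProjectionOnto
  have hPT : ∀ t : T, P (t : V) = t := fun t => T.orthogonalProjectionOnto_mem_subspace_eq_self t
  have hPapp : ApproximatesLinearOn (fun t => P (α t)) (A : T →L[ℝ] T) U δ := by
    intro x hx y hy
    have h5 := happ x hx y hy
    have h6 : P (α x) - P (α y) - A (x - y) = P (α x - α y - ((A (x - y) : T) : V)) := by
      rw [map_sub P, map_sub P, hPT]
    change ‖P (α x) - P (α y) - A (x - y)‖ ≤ _
    rw [h6]
    exact (T.norm_orthogonalProjectionOnto_apply_le _).trans h5
  have hlow : ∀ x ∈ U, ∀ y ∈ U, (κ - δ) * ‖x - y‖ ≤ ‖P (α x) - P (α y)‖ := by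
    intro x hx y hy
    have h5 : ‖P (α x) - P (α y) - A (x - y)‖ ≤ δ * ‖x - y‖ := hPapp x hx y hy
    have h6 := hAκ (x - y)
    have h7 := norm_sub_norm_le (A (x - y)) (A (x - y) - (P (α x) - P (α y)))
    rw [sub_sub_cancel, norm_sub_rev (A (x - y))] at h7
    linarith
  have hup : ∀ x ∈ U, ∀ y ∈ U, ‖α x - α y‖ ≤ K * ‖P (α x) - P (α y)‖ := by
    intro x hx y hy
    have h5 : ‖α x - α y - ((A (x - y) : T) : V)‖ ≤ δ * ‖x - y‖ := happ x hx y hy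
    have h6 := hlow x hx y hy
    -- the normal component of `α x - α y` is that of the linearization error
    have h7 : ‖(α x - α y) - T.starProjection (α x - α y)‖ ≤ δ * ‖x - y‖ := by
      refine le_trans ?_ h5
      have h8 : (α x - α y) - T.starProjection (α x - α y)
          = Tᗮ.starProjection (α x - α y - ((A (x - y) : T) : V)) := by
        rw [map_sub Tᗮ.starProjection (α x - α y), Submodule.starProjection_orthogonal_val (α x - α y),
          (Submodule.starProjection_apply_eq_zero_iff Tᗮ).2, sub_zero]
        exact Submodule.le_orthogonal_orthogonal T (A (x - y)).2
      rw [h8]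
      exact Tᗮ.norm_starProjection_apply_le _
    have h9 : ‖T.starProjection (α x - α y)‖ = ‖P (α x) - P (α y)‖ := by
      rw [← map_sub]; rfl
    have h10 := norm_add_le ((α x - α y) - T.starProjection (α x - α y)) (T.starProjection (α x - α y))
    rw [sub_add_cancel, h9] at h10
    have h11 : (δ : ℝ) * ‖x - y‖ ≤ (K - 1) * ‖P (α x) - P (α y)‖ := by
      have hK1' : (0 : ℝ) < K - 1 := by
        have : (1 : ℝ) < K := by exact_mod_cast hK1
        linarith
      calc (δ : ℝ) * ‖x - y‖ ≤ ((K - 1) * (κ - δ)) * ‖x - y‖ := by gcongr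
        _ = (K - 1) * ((κ - δ) * ‖x - y‖) := by ring
        _ ≤ _ := by gcongr
    linarith
  have hinjP : ∀ x ∈ U, ∀ y ∈ U, P (α x) = P (α y) → x = y := by
    intro x hx y hy hxy
    have h5 := hlow x hx y hy
    rw [hxy, sub_self, norm_zero] at h5
    have h6 : ‖x - y‖ ≤ 0 := by
      by_contra h
      push Not at h
      have : 0 < (κ - δ) * ‖x - y‖ := mul_pos (by linarith) h
      linarith
    exact sub_eq_zero.1 (norm_le_zero_iff.1 h6)
  refine ⟨U, hU, fun x hx y hy hxy => hinjP x hx y hy (by rw [hxy]), happ.continuousOn,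
    fun S hS => ⟨?_, ?_⟩⟩
  · calc (a : ℝ≥0∞) * μHE[finrank ℝ T] S
        ≤ μHE[finrank ℝ T] ((fun t => P (α t)) '' S) := h2 S _ (hPapp.mono_set hS)
      _ = μHE[finrank ℝ T] (P '' (α '' S)) := by rw [image_image]
      _ ≤ _ := image_projection_le T _ _
  · have hLip : LipschitzOnWith K (fun q : T => α (Function.invFunOn (fun t => P (α t)) S q))
        ((fun t => P (α t)) '' S) := by
      have hinv : LeftInvOn (Function.invFunOn (fun t => P (α t)) S) (fun t => P (α t)) S :=
        InjOn.leftInvOn_invFunOn fun x hx y hy => hinjP x (hS hx) y (hS hy)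
      refine LipschitzOnWith.of_dist_le_mul ?_
      rintro _ ⟨x, hx, rfl⟩ _ ⟨y, hy, rfl⟩
      have k1 := hinv hx
      have k2 := hinv hy
      simp only at k1 k2 ⊢
      rw [k1, k2, dist_eq_norm, dist_eq_norm]
      exact hup x (hS hx) y (hS hy)
    have himg : (fun q : T => α (Function.invFunOn (fun t => P (α t)) S q)) ''
        ((fun t => P (α t)) '' S) = α '' S := by
      have hinv : LeftInvOn (Function.invFunOn (fun t => P (α t)) S) (fun t => P (α t)) S :=
        InjOn.leftInvOn_invFunOn fun x hx y hy => hinjP x (hS hx) y (hS hy)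
      rw [image_image]
      exact image_congr fun x hx => congrArg α (hinv hx)
    have k1 := euclideanHausdorffMeasure_image_le hLip (finrank ℝ T)
    rw [himg] at k1
    calc μHE[finrank ℝ T] (α '' S)
        ≤ (K : ℝ≥0∞) ^ finrank ℝ T * μHE[finrank ℝ T] ((fun t => P (α t)) '' S) := k1
      _ ≤ (K : ℝ≥0∞) ^ finrank ℝ T * (b' * μHE[finrank ℝ T] S) := by
          gcongr; exact h1 S _ (hPapp.mono_set hS)
      _ = ((K ^ finrank ℝ T * b' : ℝ≥0) : ℝ≥0∞) * μHE[finrank ℝ T] S := by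
          push_cast; ring
      _ ≤ _ := by gcongr

/-- Integrating a multiplicity: finitely many measurable subsets which cover every point of `O`
exactly `k` times have total measure `k` times that of `O`. -/
theorem sum_measure_eq_mul {X ι : Type*} [MeasurableSpace X] [Fintype ι] (μ : Measure X)
    {D : ι → Set X} {O : Set X} {k : ℕ} (hD : ∀ i, MeasurableSet (D i)) (hO : MeasurableSet O)
    (hDO : ∀ i, D i ⊆ O) (hk : ∀ y ∈ O, Nat.card {i // y ∈ D i} = k) :
    ∑ i, μ (D i) = k * μ O := by
  classical
  have h1 : ∀ y, ∑ i, (D i).indicator (fun _ => (1 : ℝ≥0∞)) y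
      = O.indicator (fun _ => (k : ℝ≥0∞)) y := by
    intro y
    by_cases hy : y ∈ O
    · rw [indicator_of_mem hy, ← hk y hy, Nat.card_eq_fintype_card, Fintype.card_subtype]
      simp [indicator_apply]
    · rw [indicator_of_notMem hy]
      exact Finset.sum_eq_zero fun i _ => indicator_of_notMem (fun h => hy (hDO i h)) _
  calc ∑ i, μ (D i) = ∑ i, ∫⁻ y, (D i).indicator (fun _ => (1 : ℝ≥0∞)) y ∂μ := by
        refine Finset.sum_congr rfl fun i _ => ?_
        rw [lintegral_indicator_const (hD i), one_mul]
    _ = ∫⁻ y, ∑ i, (D i).indicator (fun _ => (1 : ℝ≥0∞)) y ∂μ :=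
        (lintegral_finsetSum _ fun i _ => measurable_const.indicator (hD i)).symm
    _ = _ := by
        simp_rw [h1]
        rw [lintegral_indicator_const hO]

end Area

/-! ### Counting sheets -/

namespace OrthogonalRep

variable {E G V : Type*} [NormedAddCommGroup E] [NormedSpace ℝ E]
  [TopologicalSpace G] [ChartedSpace E G] [Group G]
  [NormedAddCommGroup V] [InnerProductSpace ℝ V] {π : OrthogonalRep E G V}

/-- If `G_w ≤ G_u`, the covering `G w → G u`, `g w ↦ g u` has `[G_u : G_w]` sheets. Here it is
expressed through a decomposition of `G w` into disjoint pieces `g_i a(S_i) w`, whose images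
`g_i a(S_i) u` cover `G u` with that multiplicity. -/
theorem card_pieces {n : ℕ} {T : Type*} {w u : V} (hle : π.isotropy w ≤ π.isotropy u)
    (g : Fin n → G) (a : T → G) (S : Fin n → Set T)
    (hS : ∀ p ∈ π.orbit w, ∃! q : Fin n × T, q.2 ∈ S q.1 ∧ π.toHom (g q.1 * a q.2) w = p)
    (hinj : ∀ i, InjOn (fun t => π.toHom (a t) u) (S i)) {y : V} (hy : y ∈ π.orbit u) :
    Nat.card {i // y ∈ (fun t => π.toHom (g i * a t) u) '' S i}
      = (π.isotropy w).relIndex (π.isotropy u) := by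
  obtain ⟨b, rfl⟩ := hy
  have hmem : ∀ h h' : G, π.toHom h w = π.toHom h' w ↔ h⁻¹ * h' ∈ π.isotropy w := by
    intro h h'
    rw [mem_isotropy, toHom_mul_apply]
    constructor
    · intro k; rw [← k, toHom_inv_toHom]
    · intro k
      have := congrArg (π.toHom h) k
      rwa [toHom_toHom_inv, eq_comm] at this
  have hmem' : ∀ h h' : G, π.toHom h w = π.toHom h' w → π.toHom h u = π.toHom h' u := by
    intro h h' k
    have h1 := hle ((hmem h h').1 k)
    rw [mem_isotropy, toHom_mul_apply] at h1
    have := congrArg (π.toHom h) h1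
    rwa [toHom_toHom_inv, eq_comm] at this
  choose q hq hq' using fun h : π.isotropy u => hS (π.toHom (b * h) w) ⟨_, rfl⟩
  simp only at hq hq'
  rw [Subgroup.relIndex, Subgroup.index]
  have hy : ∀ h : π.isotropy u, π.toHom (g (q h).1 * a (q h).2) u = π.toHom b u := by
    intro h
    have h1 := hmem' _ _ (hq h).2
    rw [h1, toHom_mul_apply]
    exact congrArg (π.toHom b) h.2
  let f : π.isotropy u → {i // π.toHom b u ∈ (fun t => π.toHom (g i * a t) u) '' S i} :=
    fun h => ⟨(q h).1, (q h).2, (hq h).1, hy h⟩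
  have hf : ∀ h h' : π.isotropy u, f h = f h' ↔
      h⁻¹ * h' ∈ (π.isotropy w).subgroupOf (π.isotropy u) := by
    intro h h'
    have e : h⁻¹ * h' ∈ (π.isotropy w).subgroupOf (π.isotropy u) ↔
        π.toHom (b * h) w = π.toHom (b * h') w := by
      rw [hmem, Subgroup.mem_subgroupOf]
      simp [mul_assoc]
    rw [e]
    constructor
    · intro hff
      have h1 : (q h).1 = (q h').1 := congrArg Subtype.val hff
      have h2 : (q h).2 = (q h').2 := by
        refine hinj (q h').1 (h1 ▸ (hq h).1) (hq h').1 ?_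
        have h3 := (hy h).trans (hy h').symm
        rw [h1, toHom_mul_apply, toHom_mul_apply] at h3
        exact (π.toHom _).injective h3
      rw [← (hq h).2, ← (hq h').2, h1, h2]
    · intro hw
      have : q h = q h' := hq' h' _ ⟨(hq h).1, (hq h).2.trans hw⟩
      exact Subtype.ext (congrArg Prod.fst this)
  symm
  refine Nat.card_congr (Equiv.ofBijective
    (Quotient.lift f fun h h' hh => (hf h h').2 (QuotientGroup.leftRel_apply.1 hh)) ⟨?_, ?_⟩)
  · rintro ⟨h⟩ ⟨h'⟩ hh
    exact Quotient.sound (QuotientGroup.leftRel_apply.2 ((hf h h').1 hh))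
  · rintro ⟨i, t, ht, hti⟩
    simp only at hti
    have hh : b⁻¹ * (g i * a t) ∈ π.isotropy u := by
      rw [mem_isotropy, toHom_mul_apply, hti, toHom_inv_toHom]
    refine ⟨QuotientGroup.mk ⟨_, hh⟩, ?_⟩
    refine Subtype.ext ?_
    change (q ⟨_, hh⟩).1 = i
    have := hq' ⟨_, hh⟩ (i, t) ⟨ht, by simp⟩
    rw [← this]

variable [FiniteDimensional ℝ V] [MeasurableSpace V] [BorelSpace V]

/-- The volumes of the images of the pieces add up to the volume of the orbit, counted with the number
of sheets. -/
theorem measure_pieces [CompactSpace G] {n : ℕ} {T : Type*} [TopologicalSpace T] [PolishSpace T]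
    [MeasurableSpace T] [BorelSpace T] {w u : V} (hle : π.isotropy w ≤ π.isotropy u)
    (g : Fin n → G) (a : T → G) (S : Fin n → Set T) (hSm : ∀ i, MeasurableSet (S i))
    (hS : ∀ p ∈ π.orbit w, ∃! q : Fin n × T, q.2 ∈ S q.1 ∧ π.toHom (g q.1 * a q.2) w = p)
    (hinj : ∀ i, InjOn (fun t => π.toHom (a t) u) (S i))
    (hcont : ∀ i, ContinuousOn (fun t => π.toHom (a t) u) (S i)) (m : ℕ) :
    ∑ i, μHE[m] ((fun t => π.toHom (a t) u) '' S i)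
      = (π.isotropy w).relIndex (π.isotropy u) * μHE[m] (π.orbit u) := by
  have himg : ∀ i, (fun t => π.toHom (g i * a t) u) '' S i
      = π.toHom (g i) '' ((fun t => π.toHom (a t) u) '' S i) := by
    intro i
    rw [image_image]
    exact image_congr fun t _ => π.toHom_mul_apply _ _ _
  rw [← sum_measure_eq_mul μHE[m] (D := fun i => (fun t => π.toHom (g i * a t) u) '' S i)
    (O := π.orbit u) (k := (π.isotropy w).relIndex (π.isotropy u))]
  · refine Finset.sum_congr rfl fun i _ => ?_
    rw [himg, (π.toHom (g i)).isometry.euclideanHausdorffMeasure_image]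
  · intro i
    refine (hSm i).image_of_continuousOn_injOn ?_ ?_
    · exact ((π.toHom (g i)).continuous.comp_continuousOn (hcont i)).congr
        fun t _ => π.toHom_mul_apply _ _ _
    · intro t ht t' ht' htt
      refine hinj i ht ht' ?_
      simp only [toHom_mul_apply] at htt
      exact (π.toHom _).injective htt
  · exact (isCompact_range (π.continuous_toHom_apply u)).isClosed.measurableSet
  · rintro i _ ⟨t, -, rfl⟩
    exact ⟨_, rfl⟩
  · intro y hy
    exact card_pieces hle g a S hS hinj hy

/-- A decomposition of the compact orbit `G w` into finitely many disjoint translated measurable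
pieces of a compact set on which a local parametrization is injective. The first piece is the whole
set, which keeps the total measure of the pieces positive. -/
theorem exists_pieces {T : Type*} [TopologicalSpace T] [MeasurableSpace T] [BorelSpace T] {w : V}
    (a : T → G) {B : Set T} (hB : IsClosed B) (hBc : IsCompact B)
    (hinj : InjOn (fun t => π.toHom (a t) w) B) (hcont : ContinuousOn (fun t => π.toHom (a t) w) B)
    {n : ℕ} (g : Fin n → G)
    (hcov : ∀ p ∈ π.orbit w, ∃ i, ∃ t ∈ B, π.toHom (g i * a t) w = p) :
    ∃ S : Fin n → Set T, (∀ i, MeasurableSet (S i)) ∧ (∀ i, S i ⊆ B) ∧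
      (∀ i : Fin n, (i : ℕ) = 0 → S i = B) ∧
      ∀ p ∈ π.orbit w, ∃! q : Fin n × T, q.2 ∈ S q.1 ∧ π.toHom (g q.1 * a q.2) w = p := by
  let C : Fin n → Set V := fun j => (fun t => π.toHom (g j * a t) w) '' B
  have hci : ∀ j, ContinuousOn (fun t => π.toHom (g j * a t) w) B := fun j =>
    ((π.toHom (g j)).continuous.comp_continuousOn hcont).congr fun t _ => π.toHom_mul_apply _ _ _
  have hC : ∀ j, IsClosed (C j) := fun j => (hBc.image_of_continuousOn (hci j)).isClosed
  refine ⟨fun i => B \ ⋃ j : Fin n, ⋃ _ : j < i, B ∩ (fun t => π.toHom (g i * a t) w) ⁻¹' C j,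
    fun i => ?_, fun i => sdiff_subset, fun i hi => ?_, fun p hp => ?_⟩
  · refine hB.measurableSet.diff (MeasurableSet.iUnion fun j => MeasurableSet.iUnion fun _ => ?_)
    exact ((hci i).preimage_isClosed_of_isClosed hB (hC j)).measurableSet
  · ext t
    simp only [Set.mem_sdiff, mem_iUnion, not_exists, and_iff_left_iff_imp]
    intro _ j hj
    exact absurd (Fin.lt_def.1 hj) (by omega)
  · -- the first piece containing `p`
    classical
    let P : Fin n → Prop := fun i => p ∈ C i
    have hP : (Finset.univ.filter P).Nonempty := by
      obtain ⟨i, t, ht, hi⟩ := hcov p hp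
      exact ⟨i, Finset.mem_filter.2 ⟨Finset.mem_univ _, t, ht, hi⟩⟩
    set i₀ := (Finset.univ.filter P).min' hP with hi₀
    obtain ⟨t₀, ht₀, htp⟩ : p ∈ C i₀ := (Finset.mem_filter.1 (Finset.min'_mem _ hP)).2
    simp only at htp
    refine ⟨(i₀, t₀), ⟨⟨ht₀, ?_⟩, htp⟩, ?_⟩
    · simp only [mem_iUnion, not_exists]
      rintro j hj ⟨-, hj2⟩
      rw [mem_preimage, htp] at hj2
      exact absurd (Finset.min'_le _ j (Finset.mem_filter.2 ⟨Finset.mem_univ _, hj2⟩)) (not_le.2 hj)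
    · rintro ⟨i, t⟩ ⟨⟨ht, ht'⟩, hit⟩
      simp only at ht ht' hit
      have h1 : i₀ ≤ i :=
        Finset.min'_le _ i (Finset.mem_filter.2 ⟨Finset.mem_univ _, t, ht, hit⟩)
      have h2 : i = i₀ := by
        by_contra hne
        refine ht' (mem_iUnion₂.2 ⟨i₀, lt_of_le_of_ne h1 (Ne.symm hne), ht, ?_⟩)
        rw [mem_preimage, hit]
        exact ⟨t₀, ht₀, htp⟩
      subst h2
      have h3 : t = t₀ := by
        refine hinj ht ht₀ ?_
        have := hit.trans htp.symm
        rw [toHom_mul_apply, toHom_mul_apply] at this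
        exact (π.toHom _).injective this
      rw [h3]

end OrthogonalRep

/-! ### Volumes of orbits -/

namespace OrthogonalRep

variable {E G V : Type*} [NormedAddCommGroup E] [NormedSpace ℝ E]
  [TopologicalSpace G] [ChartedSpace E G] [Group G]
  [NormedAddCommGroup V] [InnerProductSpace ℝ V] {π : OrthogonalRep E G V}
  [FiniteDimensional ℝ V] [FiniteDimensional ℝ E] [LieGroup 𝓘(ℝ, E) ∞ G]

/-- The endomorphism of the tangent space `𝔤 · w` comparing the infinitesimal actions at `w` and
at `u`: it sends `x · w` to the tangential part of `x · u`, for `x` in the range of the chosen right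
inverse of the infinitesimal action at `w`. -/
def SliceChart.relMap {w : V} (S : π.SliceChart w) (u : V) : π.tan w →L[ℝ] π.tan w :=
  (π.tan w).orthogonalProjectionOnto ∘L π.infCLM u ∘L S.s ∘L (π.tan w).subtypeL

/-- The derivative of the orbit map of `u` in the tangential slice coordinates at `w`. -/
theorem SliceChart.hasStrictFDerivAt_localAct {w : V} (S : π.SliceChart w) (u : V) :
    HasStrictFDerivAt (fun t : π.tan w => π.localAct (S.s t) u)
      (π.infCLM u ∘L S.s ∘L (π.tan w).subtypeL) 0 := by
  have h1 : HasStrictFDerivAt π.localAct (fderiv ℝ π.localAct 0)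
      ((S.s ∘L (π.tan w).subtypeL) 0) := by
    rw [map_zero]
    exact π.eventually_contDiffAt_localAct.self_of_nhds.hasStrictFDerivAt (by simp)
  have h2 := (ContinuousLinearMap.apply ℝ V u).hasStrictFDerivAt.comp (0 : π.tan w)
    (h1.comp (0 : π.tan w) (S.s ∘L (π.tan w).subtypeL).hasStrictFDerivAt)
  convert! h2 using 1
  ext t
  exact (π.fderiv_localAct_zero (S.s t) u).symm

variable [IsTopologicalGroup G] [CompactSpace G]

namespace IsSection

variable {c : Submodule ℝ V} (hc : π.IsSection c) {w : V} (hw : π.IsRegular w) (hwc : w ∈ c)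
  (S : π.SliceChart w)
include hc hw hwc

theorem infCLM_mem_tan {u : V} (hu : u ∈ c) (x : E) : π.infCLM u x ∈ π.tan w := by
  rw [hc.tan_eq hw hwc, Submodule.mem_orthogonal']
  exact fun v hv => hc.inner_eq_zero u hu x v hv

theorem coe_relMap {u : V} (hu : u ∈ c) (t : π.tan w) :
    (S.relMap u t : V) = π.infCLM u (S.s t) :=
  Submodule.starProjection_eq_self_iff.2 (hc.infCLM_mem_tan hw hwc hu (S.s t))

/-- Along a section the infinitesimal action factors through that at a regular point. -/
theorem infCLM_eq_relMap {u : V} (hu : u ∈ c) (x : E) :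
    π.infCLM u x = S.relMap u ⟨π.infCLM w x, π.infCLM_mem_tan w x⟩ := by
  rw [hc.coe_relMap hw hwc S hu]
  have h1 : π.infCLM w (x - S.s (π.infCLM w x)) = 0 := by
    rw [map_sub, S.infCLM_s, π.tanProj_of_mem (π.infCLM_mem_tan w x), sub_self]
  have h2 := hc.infCLM_eq_zero hw hwc hu h1
  rw [map_sub, sub_eq_zero] at h2
  exact h2

theorem relMap_self : S.relMap w = ContinuousLinearMap.id ℝ (π.tan w) := by
  ext t
  rw [hc.coe_relMap hw hwc S hwc, S.infCLM_s, π.tanProj_of_mem t.2]; rfl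

theorem map_range_relMap {u : V} (hu : u ∈ c) :
    (LinearMap.range (S.relMap u : π.tan w →ₗ[ℝ] π.tan w)).map (π.tan w).subtype = π.tan u := by
  apply le_antisymm
  · rintro _ ⟨_, ⟨t, rfl⟩, rfl⟩
    change (S.relMap u t : V) ∈ _
    rw [hc.coe_relMap hw hwc S hu]
    exact π.infCLM_mem_tan _ _
  · rintro _ ⟨x, rfl⟩
    exact ⟨_, ⟨_, rfl⟩, (hc.infCLM_eq_relMap hw hwc S hu x).symm⟩

theorem isRegular_iff_det_ne_zero {u : V} (hu : u ∈ c) :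
    π.IsRegular u ↔ (S.relMap u).det ≠ 0 := by
  have h1 : π.orbitDim u = finrank ℝ (LinearMap.range (S.relMap u : π.tan w →ₗ[ℝ] π.tan w)) := by
    rw [orbitDim_eq_finrank_tan, ← hc.map_range_relMap hw hwc S hu, Submodule.finrank_map_subtype_eq]
  have h2 : (S.relMap u).det ≠ 0 ↔
      LinearMap.range (S.relMap u : π.tan w →ₗ[ℝ] π.tan w) = ⊤ := by
    rw [← LinearMap.isUnit_iff_range_eq_top, LinearMap.isUnit_iff_isUnit_det]
    exact isUnit_iff_ne_zero.symm
  rw [h2, isRegular_iff, h1, ← hw.finrank_tan]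
  exact ⟨fun h => Submodule.eq_top_of_finrank_eq h, fun h => by rw [h, finrank_top]⟩

variable [MeasurableSpace V] [BorelSpace V]

/-- The volumes of the orbits of two points `w`, `u` of a section, the first of which has the least
possible isotropy group, are compared with the total measure `L` of finitely many small pieces of
`𝔤 · w`. These parametrize `G w` with local distortion close to `1`, and `G u`, with the multiplicity
of the covering `G w → G u`, with local distortion close to the determinant of the comparison map. -/
theorem exists_volume_bounds (hwH : π.isotropy w = π.fixer c) {u : V} (hu : π.IsRegular u)
    (huc : u ∈ c) {a₀ b₀ a₁ b₁ : ℝ≥0} (ha₀ : a₀ < 1) (hb₀ : 1 < b₀)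
    (ha₁ : a₁ < ‖(S.relMap u).det‖₊) (hb₁ : ‖(S.relMap u).det‖₊ < b₁) :
    ∃ L : ℝ≥0∞, L ≠ 0 ∧ L ≠ ⊤ ∧
      a₀ * L ≤ μHE[π.maxDim] (π.orbit w) ∧ μHE[π.maxDim] (π.orbit w) ≤ b₀ * L ∧
      a₁ * L ≤ (π.coveringIndex u : ℝ≥0∞) * μHE[π.maxDim] (π.orbit u) ∧
      (π.coveringIndex u : ℝ≥0∞) * μHE[π.maxDim] (π.orbit u) ≤ b₁ * L := by
  have hofReal : ∀ x : ℝ, ENNReal.ofReal |x| = (‖x‖₊ : ℝ≥0∞) := fun x => by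
    rw [← Real.norm_eq_abs, ofReal_norm, enorm_eq_nnnorm]
  -- the local bounds for the two orbit maps
  have hloc : ∀ v ∈ c, π.IsRegular v → ∀ a b : ℝ≥0, a < ‖(S.relMap v).det‖₊ →
      ‖(S.relMap v).det‖₊ < b → ∃ U ∈ 𝓝 (0 : π.tan w),
        InjOn (fun t : π.tan w => π.localAct (S.s t) v) U ∧
        ContinuousOn (fun t : π.tan w => π.localAct (S.s t) v) U ∧ ∀ Z ⊆ U,
        a * μHE[finrank ℝ (π.tan w)] Z ≤
          μHE[finrank ℝ (π.tan w)] ((fun t : π.tan w => π.localAct (S.s t) v) '' Z) ∧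
        μHE[finrank ℝ (π.tan w)] ((fun t : π.tan w => π.localAct (S.s t) v) '' Z) ≤
          b * μHE[finrank ℝ (π.tan w)] Z := by
    intro v hvc hv a b ha hb
    have hdet := (hc.isRegular_iff_det_ne_zero hw hwc S hvc).1 hv
    let A : π.tan w ≃L[ℝ] π.tan w := (S.relMap v).toContinuousLinearEquivOfDetNeZero hdet
    have hA : (A : π.tan w →L[ℝ] π.tan w) = S.relMap v :=
      ContinuousLinearMap.coe_toContinuousLinearEquivOfDetNeZero _ _
    have hα := S.hasStrictFDerivAt_localAct v
    have hfac : (π.infCLM v ∘L S.s ∘L (π.tan w).subtypeL)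
        = (π.tan w).subtypeL ∘L (A : π.tan w →L[ℝ] π.tan w) := by
      rw [hA]; ext t; exact (hc.coe_relMap hw hwc S hvc t).symm
    rw [hfac] at hα
    refine exists_nhds_measure_image_bounds A hα ?_ ?_
    · rw [hA, hofReal]; exact_mod_cast ha
    · rw [hA, hofReal]; exact_mod_cast hb
  have hself : ‖(S.relMap w).det‖₊ = 1 := by
    rw [hc.relMap_self hw hwc S, ContinuousLinearMap.det]
    simp
  obtain ⟨U₀, hU₀, hinj₀, hcont₀, hb₀⟩ := hloc w hwc hw a₀ b₀ (hself ▸ ha₀) (hself ▸ hb₀)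
  obtain ⟨U₁, hU₁, hinj₁, hcont₁, hb₁⟩ := hloc u huc hu a₁ b₁ ha₁ hb₁
  obtain ⟨ρ, hρ, hball⟩ := Metric.nhds_basis_closedBall.mem_iff.1 (inter_mem hU₀ hU₁)
  set B := Metric.closedBall (0 : π.tan w) ρ with hB
  have hB₀ : B ⊆ U₀ := fun t ht => (hball ht).1
  have hB₁ : B ⊆ U₁ := fun t ht => (hball ht).2
  let a : π.tan w → G := fun t => chartParam E G (S.s t)
  -- finitely many translates of the local orbit through `w` cover the orbit
  have hO : ∀ᶠ k in 𝓝 (1 : G), ∃ t ∈ B, π.toHom k w = π.toHom (a t) w := by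
    refine nhds_one_le_map_chartParam E G (mem_map.2 ?_)
    let τ : V → π.tan w := fun v => ⟨π.tanProj w v, π.tanProj_mem w v⟩
    have hτ : Tendsto τ (𝓝 w) (𝓝 0) := by
      have h1 : Continuous τ := (π.tanProj w).continuous.subtype_mk _
      have h2 := h1.tendsto w
      have h3 : τ w = 0 :=
        Subtype.ext (π.tanProj_of_mem_orthogonal (π.self_mem_tan_orthogonal w))
      rwa [h3] at h2
    have h4 := (hτ.comp (S.tendsto_symm.comp (SliceChart.tendsto_localAct_apply π w))).eventually
      (Metric.closedBall_mem_nhds (0 : π.tan w) hρ)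
    filter_upwards [S.eventually_localAct_eq hw, h4] with z h5 h6
    refine ⟨_, h6, ?_⟩
    have h7 : S.s (τ (S.chart.symm (π.localAct z w)) : V) = S.s (S.chart.symm (π.localAct z w)) := by
      conv_rhs => rw [← π.tanProj_add_norProj w (S.chart.symm (π.localAct z w)), map_add,
        S.s_normal _ (π.norProj_mem _ _), add_zero]
    change π.localAct z w = π.localAct (S.s (τ (S.chart.symm (π.localAct z w)))) w
    rw [h7]
    exact h5
  obtain ⟨F, -, hF⟩ := isCompact_univ.elim_nhds_subcover
    (fun f : G => {k | ∃ t ∈ B, π.toHom (f⁻¹ * k) w = π.toHom (a t) w}) (fun f _ => by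
      have h3 : Tendsto (fun k : G => f⁻¹ * k) (𝓝 f) (𝓝 1) := by
        have := (continuous_const_mul f⁻¹ : Continuous fun k : G => f⁻¹ * k).tendsto f
        rwa [inv_mul_cancel] at this
      exact h3 hO)
  let g : Fin F.card → G := fun i => F.equivFin.symm i
  have hcov : ∀ p ∈ π.orbit w, ∃ i, ∃ t ∈ B, π.toHom (g i * a t) w = p := by
    rintro _ ⟨k, rfl⟩
    obtain ⟨f, hf, t, ht, hk⟩ := mem_iUnion₂.1 (hF (mem_univ k))
    refine ⟨F.equivFin ⟨f, hf⟩, t, ht, ?_⟩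
    simp only [g, Equiv.symm_apply_apply]
    rw [toHom_mul_apply, ← hk, ← toHom_mul_apply, mul_inv_cancel_left]
  have hcard : 0 < F.card := by
    obtain ⟨i, -⟩ := hcov w ⟨1, by simp⟩
    exact i.pos
  obtain ⟨Z, hZm, hZB, hZ0, hZ⟩ := exists_pieces (π := π) (w := w) a Metric.isClosed_closedBall
    (isCompact_closedBall (0 : π.tan w) ρ) (hinj₀.mono hB₀) (hcont₀.mono hB₀) g hcov
  have hk : π.coveringIndex u = (π.isotropy w).relIndex (π.isotropy u) := by
    rw [hc.coveringIndex_eq hu huc, hwH]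
  have hm : finrank ℝ (π.tan w) = π.maxDim := hw.finrank_tan
  have hsum₀ := measure_pieces (π := π) (w := w) (u := w) le_rfl g a Z hZm hZ
    (fun i => hinj₀.mono ((hZB i).trans hB₀)) (fun i => hcont₀.mono ((hZB i).trans hB₀)) π.maxDim
  have hsum₁ := measure_pieces (π := π) (w := w) (u := u) (hwH ▸ π.fixer_le_isotropy huc) g a Z hZm hZ
    (fun i => hinj₁.mono ((hZB i).trans hB₁)) (fun i => hcont₁.mono ((hZB i).trans hB₁)) π.maxDim
  rw [Subgroup.relIndex_self, Nat.cast_one, one_mul] at hsum₀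
  rw [← hk] at hsum₁
  rw [← hsum₀, ← hsum₁, ← hm]
  refine ⟨∑ i, μHE[finrank ℝ (π.tan w)] (Z i), ?_, ?_, ?_, ?_, ?_, ?_⟩
  · intro h0
    have h1 := (Finset.sum_eq_zero_iff.1 h0) ⟨0, hcard⟩ (Finset.mem_univ _)
    rw [hZ0 _ rfl] at h1
    exact (Metric.measure_closedBall_pos (μHE[finrank ℝ (π.tan w)] : Measure (π.tan w)) 0 hρ).ne' h1
  · refine (ENNReal.sum_lt_top.2 fun i _ => ?_).ne
    exact (measure_mono (hZB i)).trans_lt (isCompact_closedBall (0 : π.tan w) ρ).measure_lt_top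
  · rw [Finset.mul_sum]
    exact Finset.sum_le_sum fun i _ => (hb₀ (Z i) ((hZB i).trans hB₀)).1
  · rw [Finset.mul_sum]
    exact Finset.sum_le_sum fun i _ => (hb₀ (Z i) ((hZB i).trans hB₀)).2
  · rw [Finset.mul_sum]
    exact Finset.sum_le_sum fun i _ => (hb₁ (Z i) ((hZB i).trans hB₁)).1
  · rw [Finset.mul_sum]
    exact Finset.sum_le_sum fun i _ => (hb₁ (Z i) ((hZB i).trans hB₁)).2

theorem orbitVolume_pos (hwH : π.isotropy w = π.fixer c) : 0 < π.orbitVolume w := by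
  obtain ⟨S⟩ := π.nonempty_sliceChart w
  have hself : ‖(S.relMap w).det‖₊ = 1 := by
    rw [hc.relMap_self hw hwc S, ContinuousLinearMap.det]
    simp
  obtain ⟨L, hL0, hLt, h1, h2, -⟩ := hc.exists_volume_bounds hw hwc S hwH hw hwc
    (a₀ := 1 / 2) (b₀ := 2) (a₁ := 1 / 2) (b₁ := 2) (NNReal.half_lt_self one_ne_zero) one_lt_two
    (by rw [hself]; exact (NNReal.half_lt_self one_ne_zero)) (by rw [hself]; exact one_lt_two)
  refine ENNReal.toReal_pos ?_ ?_
  · intro h0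
    rw [h0, nonpos_iff_eq_zero, mul_eq_zero] at h1
    simp [hL0] at h1
  · exact ne_top_of_le_ne_top (ENNReal.mul_ne_top (by simp) hLt) h2

/-- The volume of a regular orbit `G u`, weighted by the covering index, is proportional to the
determinant of the comparison map of infinitesimal actions. -/
theorem coveringIndex_mul_orbitVolume (hwH : π.isotropy w = π.fixer c) {u : V}
    (hu : π.IsRegular u) (huc : u ∈ c) :
    π.coveringIndex u * π.orbitVolume u = |(S.relMap u).det| * π.orbitVolume w := by
  have hd0 := (hc.isRegular_iff_det_ne_zero hw hwc S huc).1 hu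
  set d := ‖(S.relMap u).det‖₊ with hd
  have hdpos : 0 < d := by simpa [hd] using hd0
  have hdr : (d : ℝ) = |(S.relMap u).det| := by simp [hd]
  set x := π.coveringIndex u * π.orbitVolume u with hx
  set y := π.orbitVolume w with hy
  have hxe : x = ((π.coveringIndex u : ℝ≥0∞) * μHE[π.maxDim] (π.orbit u)).toReal := by
    rw [ENNReal.toReal_mul, ENNReal.toReal_natCast]; rfl
  have hye : y = (μHE[π.maxDim] (π.orbit w)).toReal := rfl
  have key : ∀ r : ℝ, 0 < r → r < 1 → r ^ 2 * (d * y) ≤ x ∧ r ^ 2 * x ≤ d * y := by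
    intro r hr hr1
    lift r to ℝ≥0 using hr.le
    have hr' : 0 < r := by exact_mod_cast hr
    have hr1' : r < 1 := by exact_mod_cast hr1
    have hri : 1 < r⁻¹ := (one_lt_inv₀ hr').2 hr1'
    obtain ⟨L, hL0, hLt, h1, h2, h3, h4⟩ := hc.exists_volume_bounds hw hwc S hwH hu huc
      (a₀ := r) (b₀ := r⁻¹) (a₁ := r * d) (b₁ := r⁻¹ * d) hr1' hri
      (mul_lt_of_lt_one_left hdpos hr1') (lt_mul_of_one_lt_left hdpos hri)
    have hwt : μHE[π.maxDim] (π.orbit w) ≠ ⊤ :=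
      ne_top_of_le_ne_top (ENNReal.mul_ne_top ENNReal.coe_ne_top hLt) h2
    have hut : (π.coveringIndex u : ℝ≥0∞) * μHE[π.maxDim] (π.orbit u) ≠ ⊤ :=
      ne_top_of_le_ne_top (ENNReal.mul_ne_top ENNReal.coe_ne_top hLt) h4
    have k1 := ENNReal.toReal_mono hwt h1
    have k2 := ENNReal.toReal_mono (ENNReal.mul_ne_top ENNReal.coe_ne_top hLt) h2
    have k3 := ENNReal.toReal_mono hut h3
    have k4 := ENNReal.toReal_mono (ENNReal.mul_ne_top ENNReal.coe_ne_top hLt) h4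
    rw [← hye] at k1 k2
    rw [← hxe] at k3 k4
    simp only [ENNReal.toReal_mul, ENNReal.coe_toReal, NNReal.coe_mul, NNReal.coe_inv] at k1 k2 k3 k4
    have hd' : (0 : ℝ) < d := by exact_mod_cast hdpos
    constructor
    · calc (r : ℝ) ^ 2 * (d * y) ≤ (r : ℝ) ^ 2 * (d * ((r : ℝ)⁻¹ * L.toReal)) := by gcongr
        _ = r * d * L.toReal := by field_simp
        _ ≤ x := k3
    · calc (r : ℝ) ^ 2 * x ≤ (r : ℝ) ^ 2 * ((r : ℝ)⁻¹ * d * L.toReal) := by gcongr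
        _ = d * (r * L.toReal) := by field_simp
        _ ≤ d * y := by gcongr
  rw [← hdr]
  have hlim : ∀ z : ℝ, Tendsto (fun r : ℝ => r ^ 2 * z) (𝓝[<] 1) (𝓝 z) := by
    intro z
    have : Continuous fun r : ℝ => r ^ 2 * z := by fun_prop
    have h2 := this.tendsto 1
    rw [one_pow, one_mul] at h2
    exact h2.mono_left nhdsWithin_le_nhds
  have hIoo : ∀ᶠ r in 𝓝[<] (1 : ℝ), r ∈ Ioo (0 : ℝ) 1 := Ioo_mem_nhdsLT one_pos
  refine le_antisymm ?_ ?_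
  · exact le_of_tendsto (hlim x) (hIoo.mono fun r hr => (key r hr.1 hr.2).2)
  · exact le_of_tendsto (hlim (d * y)) (hIoo.mono fun r hr => (key r hr.1 hr.2).1)

/-- On a section, the discriminant is a constant multiple of the squared determinant of the
comparison map. -/
theorem discriminant_eq (hwH : π.isotropy w = π.fixer c) {u : V} (huc : u ∈ c) :
    π.discriminant u = (S.relMap u).det ^ 2 * π.orbitVolume w ^ 2 := by
  by_cases hu : π.IsRegular u
  · rw [discriminant, if_pos hu, ← mul_pow, hc.coveringIndex_mul_orbitVolume hw hwc S hwH hu huc,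
      mul_pow, sq_abs]
  · have hd : (S.relMap u).det = 0 := by
      by_contra h
      exact hu ((hc.isRegular_iff_det_ne_zero hw hwc S huc).2 h)
    rw [discriminant, if_neg hu, hd]
    ring

end IsSection

theorem discriminant_toHom [MeasurableSpace V] [BorelSpace V] (g : G) (v : V) :
    π.discriminant (π.toHom g v) = π.discriminant v := by
  have horb : π.orbit (π.toHom g v) = π.orbit v := by
    ext p
    constructor
    · rintro ⟨h, rfl⟩
      exact ⟨h * g, π.toHom_mul_apply _ _ _⟩
    · rintro ⟨h, rfl⟩
      exact ⟨h * g⁻¹, by simp⟩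
  rw [discriminant, discriminant, coveringIndex_toHom, orbitVolume, orbitVolume, horb]
  by_cases h : π.IsRegular v
  · rw [if_pos h, if_pos (π.isRegular_toHom.2 h)]
  · rw [if_neg h, if_neg (mt π.isRegular_toHom.1 h)]

end OrthogonalRep

/-! ### Minors -/

section LinearAlgebra

/-- On the top exterior power an endomorphism acts by its determinant. -/
theorem exteriorPower_map_eq_det_smul {T : Type*} [AddCommGroup T] [Module ℝ T]
    [FiniteDimensional ℝ T] {m : ℕ} (hm : finrank ℝ T = m) (A : T →ₗ[ℝ] T) :
    exteriorPower.map m A = LinearMap.det A • LinearMap.id := by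
  apply exteriorPower.linearMap_ext
  ext1 x
  let b : Basis (Fin m) ℝ T := (finBasis ℝ T).reindex (finCongr hm)
  have key : ∀ φ : Dual ℝ (⋀[ℝ]^m T),
      φ (exteriorPower.ιMulti ℝ m (A ∘ x)) = φ (LinearMap.det A • exteriorPower.ιMulti ℝ m x) := by
    intro φ
    have h := (φ.compAlternatingMap (exteriorPower.ιMulti ℝ m)).eq_smul_basis_det b
    have h1 := congrArg (fun f : T [⋀^Fin m]→ₗ[ℝ] ℝ => f (A ∘ x)) h
    have h2 := congrArg (fun f : T [⋀^Fin m]→ₗ[ℝ] ℝ => f x) h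
    simp only [LinearMap.compAlternatingMap_apply, AlternatingMap.smul_apply, smul_eq_mul] at h1 h2
    rw [h1, map_smul, h2, Basis.det_comp]
    simp only [smul_eq_mul]
    ring
  have h3 : exteriorPower.ιMulti ℝ m (A ∘ x) - LinearMap.det A • exteriorPower.ιMulti ℝ m x = 0 := by
    rw [← forall_dual_apply_eq_zero_iff ℝ]
    intro φ
    rw [map_sub, key, sub_self]
  simpa only [LinearMap.compAlternatingMap_apply, exteriorPower.map_apply_ιMulti,
    LinearMap.smul_apply, LinearMap.id_apply] using sub_eq_zero.1 h3

theorem inner_exteriorPower_map {F : Type*} [NormedAddCommGroup F] [InnerProductSpace ℝ F]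
    [FiniteDimensional ℝ F] {m : ℕ} {f : F →ₗ[ℝ] F} (hf : ∀ x y, inner ℝ (f x) (f y) = inner ℝ x y)
    (a b : ⋀[ℝ]^m F) :
    inner ℝ (exteriorPower.map m f a) (exteriorPower.map m f b) = inner ℝ a b := by
  have h : (innerₗ (⋀[ℝ]^m F)).compl₁₂ (exteriorPower.map m f) (exteriorPower.map m f)
      = innerₗ (⋀[ℝ]^m F) := by
    apply exteriorPower.linearMap_ext
    ext1 x
    apply exteriorPower.linearMap_ext
    ext1 y
    simp [exteriorPower.map_apply_ιMulti, exteriorPower.inner_ιMulti_ιMulti, hf]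
  exact LinearMap.congr_fun (LinearMap.congr_fun h a) b

theorem inner_tensorProduct_map {F F' : Type*} [NormedAddCommGroup F] [InnerProductSpace ℝ F]
    [NormedAddCommGroup F'] [InnerProductSpace ℝ F'] {f : F →ₗ[ℝ] F} {f' : F' →ₗ[ℝ] F'}
    (hf : ∀ x y, inner ℝ (f x) (f y) = inner ℝ x y)
    (hf' : ∀ x y, inner ℝ (f' x) (f' y) = inner ℝ x y) (s t : F ⊗[ℝ] F') :
    inner ℝ (TensorProduct.map f f' s) (TensorProduct.map f f' t) = inner ℝ s t := by
  have h : (innerₗ (F ⊗[ℝ] F')).compl₁₂ (TensorProduct.map f f') (TensorProduct.map f f')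
      = innerₗ (F ⊗[ℝ] F') := by
    ext x x' y y'
    simp [TensorProduct.inner_tmul, hf, hf']
  exact LinearMap.congr_fun (LinearMap.congr_fun h s) t

variable {F : Type*} [NormedAddCommGroup F] [InnerProductSpace ℝ F] [FiniteDimensional ℝ F]

/-- The sum of the squares of the values of a functional on an orthonormal basis is the squared norm
of the functional. -/
theorem sum_sq_eq_of_orthonormal {W : Submodule ℝ F} {n : ℕ} (w w' : Basis (Fin n) ℝ W)
    (hw : ∀ i j, inner ℝ (w i : F) (w j : F) = if i = j then (1 : ℝ) else 0)
    (hw' : ∀ i j, inner ℝ (w' i : F) (w' j : F) = if i = j then (1 : ℝ) else 0) (φ : F →ₗ[ℝ] ℝ) :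
    ∑ i, φ (w i) ^ 2 = ∑ i, φ (w' i) ^ 2 := by
  let r : W := (InnerProductSpace.toDual ℝ W).symm (LinearMap.toContinuousLinearMap (φ ∘ₗ W.subtype))
  have hr : ∀ x : W, inner ℝ r x = φ x := fun x => by
    simp [r, InnerProductSpace.toDual_symm_apply]
  have key : ∀ w : Basis (Fin n) ℝ W,
      (∀ i j, inner ℝ (w i : F) (w j : F) = if i = j then (1 : ℝ) else 0) →
      ∑ i, φ (w i) ^ 2 = ‖r‖ ^ 2 := by
    intro w hw
    have ho : Orthonormal ℝ w := orthonormal_iff_ite.2 fun i j => hw i j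
    rw [← (w.toOrthonormalBasis ho).sum_sq_norm_inner_left r]
    refine Finset.sum_congr rfl fun i _ => ?_
    rw [Basis.coe_toOrthonormalBasis, hr, Real.norm_eq_abs, sq_abs]
  rw [key w hw, key w' hw']

theorem exists_orthonormal_basis (W : Submodule ℝ F) :
    ∃ w : Basis (Fin (finrank ℝ W)) ℝ W,
      ∀ i j, inner ℝ (w i : F) (w j : F) = if i = j then (1 : ℝ) else 0 := by
  refine ⟨(stdOrthonormalBasis ℝ W).toBasis, fun i j => ?_⟩
  rw [OrthonormalBasis.coe_toBasis]
  exact orthonormal_iff_ite.1 (stdOrthonormalBasis ℝ W).orthonormal i j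

theorem exists_orthogonal_complement (K : Submodule ℝ F) :
    ∃ K' : Submodule ℝ F, (∀ x, x ∈ K' ↔ ∀ k ∈ K, inner ℝ k x = (0 : ℝ)) ∧ IsCompl K K' :=
  ⟨Kᗮ, fun _ => Submodule.mem_orthogonal K _, Submodule.isCompl_orthogonal K⟩

theorem eq_of_map_eq_of_isCompl {M N : Type*} [AddCommGroup M] [Module ℝ M] [AddCommGroup N]
    [Module ℝ N] {f : M →ₗ[ℝ] N} {K : Submodule ℝ M} (hK : IsCompl (LinearMap.ker f) K) {s t : M}
    (hs : s ∈ K) (ht : t ∈ K) (h : f s = f t) : s = t := by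
  have h1 : s - t ∈ LinearMap.ker f ⊓ K :=
    ⟨by rw [SetLike.mem_coe, LinearMap.mem_ker, map_sub, h, sub_self], K.sub_mem hs ht⟩
  rw [hK.inf_eq_bot, Submodule.mem_bot] at h1
  exact sub_eq_zero.1 h1

end LinearAlgebra

namespace OrthogonalRep

variable {E G V : Type*} [NormedAddCommGroup E] [NormedSpace ℝ E]
  [TopologicalSpace G] [ChartedSpace E G] [Group G]
  [NormedAddCommGroup V] [InnerProductSpace ℝ V] {π : OrthogonalRep E G V}
  [FiniteDimensional ℝ V] [FiniteDimensional ℝ E] [LieGroup 𝓘(ℝ, E) ∞ G]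

theorem minorFun_tmul_apply (a : ⋀[ℝ]^π.maxDim (LieAlg E G)) (b : ⋀[ℝ]^π.maxDim V) (v : V) :
    π.minorFun (a ⊗ₜ b) v = inner ℝ (exteriorPower.map π.maxDim (π.infAct v) a) b := by
  simp [minorFun]

/-- The minor map is equivariant. -/
theorem minorFun_minorRep (g : G) (t : π.MinorSpace) (v : V) :
    π.minorFun (π.minorRep g t) (π.toHom g v) = π.minorFun t v := by
  induction t using TensorProduct.induction_on with
  | zero => simp
  | add s t hs ht => rw [map_add, map_add, map_add, Pi.add_apply, Pi.add_apply, hs, ht]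
  | tmul a b =>
    have h1 : π.minorRep g (a ⊗ₜ b) = (exteriorPower.map π.maxDim (adRep E G g) a) ⊗ₜ
        (exteriorPower.map π.maxDim (π.rep g) b) := rfl
    have h2 : π.infAct (π.toHom g v) ∘ₗ adRep E G g = π.rep g ∘ₗ π.infAct v :=
      LinearMap.ext fun x => (π.toHom_infAct g v x).symm
    rw [h1, minorFun_tmul_apply, minorFun_tmul_apply, ← LinearMap.comp_apply,
      ← exteriorPower.map_comp, h2, exteriorPower.map_comp, LinearMap.comp_apply]
    exact inner_exteriorPower_map (fun x y => (π.toHom g).inner_map_map x y) _ _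

theorem polyRep_minorMap (g : G) (t : π.MinorSpace) :
    polyRep π.rep π.maxDim g (π.minorMap t) = π.minorMap (π.minorRep g t) := by
  refine Subtype.ext (funext fun v => ?_)
  change π.minorFun t (π.toHom g⁻¹ v) = π.minorFun (π.minorRep g t) v
  rw [← π.minorFun_minorRep g t (π.toHom g⁻¹ v), toHom_toHom_inv]

section Inner

variable (B : InnerProductSpace.Core ℝ (LieAlg E G))

theorem minorInner_minorRep (hB : IsAdInvariant E B) (g : G) (s t : π.MinorSpace) :
    π.minorInner B (π.minorRep g s) (π.minorRep g t) = π.minorInner B s t := by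
  let _ : NormedAddCommGroup (LieAlg E G) := B.toNormedAddCommGroup
  let _ : InnerProductSpace ℝ (LieAlg E G) := InnerProductSpace.ofCore B.toCore
  exact inner_tensorProduct_map
    (fun x y => inner_exteriorPower_map (fun x y => hB g x y) x y)
    (fun x y => inner_exteriorPower_map (fun x y => (π.toHom g).inner_map_map x y) x y) s t

theorem IsOrthonormalBasis.sum_sq_eq {W : Submodule ℝ π.MinorSpace} {n : ℕ}
    {w w' : Basis (Fin n) ℝ W} (hw : π.IsOrthonormalBasis B w) (hw' : π.IsOrthonormalBasis B w')
    (φ : π.MinorSpace →ₗ[ℝ] ℝ) : ∑ i, φ (w i) ^ 2 = ∑ i, φ (w' i) ^ 2 := by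
  let _ : NormedAddCommGroup (LieAlg E G) := B.toNormedAddCommGroup
  let _ : InnerProductSpace ℝ (LieAlg E G) := InnerProductSpace.ofCore B.toCore
  exact sum_sq_eq_of_orthonormal (F := (⋀[ℝ]^π.maxDim (LieAlg E G)) ⊗[ℝ] (⋀[ℝ]^π.maxDim V)) (W := W)
    w w' (by exact hw) (by exact hw') φ

theorem exists_isOrthonormalBasis (W : Submodule ℝ π.MinorSpace) :
    ∃ w : Basis (Fin (finrank ℝ W)) ℝ W, π.IsOrthonormalBasis B w := by
  let _ : NormedAddCommGroup (LieAlg E G) := B.toNormedAddCommGroup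
  let _ : InnerProductSpace ℝ (LieAlg E G) := InnerProductSpace.ofCore B.toCore
  exact exists_orthonormal_basis (F := (⋀[ℝ]^π.maxDim (LieAlg E G)) ⊗[ℝ] (⋀[ℝ]^π.maxDim V)) W

theorem exists_minorInner_complement (K : Submodule ℝ π.MinorSpace) :
    ∃ K' : Submodule ℝ π.MinorSpace,
      (∀ x, x ∈ K' ↔ ∀ k ∈ K, π.minorInner B k x = 0) ∧ IsCompl K K' := by
  let _ : NormedAddCommGroup (LieAlg E G) := B.toNormedAddCommGroup
  let _ : InnerProductSpace ℝ (LieAlg E G) := InnerProductSpace.ofCore B.toCore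
  exact exists_orthogonal_complement (F := (⋀[ℝ]^π.maxDim (LieAlg E G)) ⊗[ℝ] (⋀[ℝ]^π.maxDim V)) K

end Inner

/-- Acting by a group element on an orthonormal basis of an invariant subspace. -/
theorem exists_translate_basis {B : InnerProductSpace.Core ℝ (LieAlg E G)}
    (hB : IsAdInvariant E B) (W : Subrepresentation π.minorRep) {n : ℕ}
    {w : Basis (Fin n) ℝ W.toSubmodule} (hw : π.IsOrthonormalBasis B w) (g : G) :
    ∃ w' : Basis (Fin n) ℝ W.toSubmodule, π.IsOrthonormalBasis B w' ∧
      ∀ i, (w' i : π.MinorSpace) = π.minorRep g (w i) := by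
  let e : W.toSubmodule ≃ₗ[ℝ] W.toSubmodule :=
    LinearEquiv.ofLinearMap (W.toRepresentation g) (W.toRepresentation g⁻¹)
      (by rw [← Module.End.mul_eq_comp, ← map_mul, mul_inv_cancel, map_one]; rfl)
      (by rw [← Module.End.mul_eq_comp, ← map_mul, inv_mul_cancel, map_one]; rfl)
  have he : ∀ i, ((w.map e i : W.toSubmodule) : π.MinorSpace) = π.minorRep g (w i) := fun i => by
    rw [Basis.map_apply]; rfl
  refine ⟨w.map e, fun i j => ?_, he⟩
  rw [he, he, minorInner_minorRep B hB]
  exact hw i j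

variable [IsTopologicalGroup G] [CompactSpace G]

/-- On a section, all values of the minor map are proportional: the infinitesimal action at `u`
factors through that at the regular point `w` by an endomorphism of the `m`-dimensional space
`𝔤 · w`, whose `m`-th exterior power is multiplication by its determinant. -/
theorem IsSection.minorFun_eq {c : Submodule ℝ V} (hc : π.IsSection c) {w : V}
    (hw : π.IsRegular w) (hwc : w ∈ c) (S : π.SliceChart w) {u : V} (hu : u ∈ c)
    (t : π.MinorSpace) :
    π.minorFun t u = (S.relMap u).det * π.minorFun t w := by
  let L : LieAlg E G →ₗ[ℝ] π.tan w := (π.infAct w).rangeRestrict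
  have h1 : π.infAct w = (π.tan w).subtype ∘ₗ L := rfl
  have h2 : π.infAct u = (π.tan w).subtype ∘ₗ (S.relMap u : π.tan w →ₗ[ℝ] π.tan w) ∘ₗ L :=
    LinearMap.ext fun x => hc.infCLM_eq_relMap hw hwc S hu x
  have h3 : exteriorPower.map π.maxDim (π.infAct u)
      = (S.relMap u).det • exteriorPower.map π.maxDim (π.infAct w) := by
    rw [h1, h2, exteriorPower.map_comp, exteriorPower.map_comp, exteriorPower.map_comp,
      exteriorPower_map_eq_det_smul hw.finrank_tan, LinearMap.smul_comp, LinearMap.comp_smul,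
      LinearMap.id_comp]
  induction t using TensorProduct.induction_on with
  | zero => simp
  | add s t hs ht => rw [map_add, Pi.add_apply, Pi.add_apply, hs, ht, mul_add]
  | tmul a b =>
    rw [minorFun_tmul_apply, minorFun_tmul_apply, h3, LinearMap.smul_apply, real_inner_smul_left]

/-- Minors which vanish at a regular point of a section vanish on the whole section, hence some minor
of an invariant subspace with nonzero image does not vanish there. -/
theorem IsSection.minorFun_ne_zero {c : Submodule ℝ V} (hc : π.IsSection c) {w : V}
    (hw : π.IsRegular w) (hwc : w ∈ c) (W : Subrepresentation π.minorRep)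
    (hW : ∃ t ∈ W.toSubmodule, π.minorMap t ≠ 0) : ∃ t ∈ W.toSubmodule, π.minorFun t w ≠ 0 := by
  obtain ⟨S⟩ := π.nonempty_sliceChart w
  obtain ⟨t, ht, htne⟩ := hW
  obtain ⟨v, hv⟩ : ∃ v, π.minorFun t v ≠ 0 := by
    by_contra h
    push Not at h
    exact htne (Subtype.ext (funext h))
  obtain ⟨g, hg⟩ := hc.exists_toHom_mem v
  refine ⟨π.minorRep g t, W.apply_mem_toSubmodule g ht, fun h0 => hv ?_⟩
  rw [← π.minorFun_minorRep g, hc.minorFun_eq hw hwc S hg, h0, mul_zero]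

variable [MeasurableSpace V] [BorelSpace V]

set_option maxHeartbeats 400000 in
/-- For every invariant subspace on which the minor map does not vanish, the sum of the squares of
the minors of an orthonormal basis is a fixed positive multiple of the discriminant. -/
theorem IsPolar.exists_sum_sq_eq (hπ : π.IsPolar) {B : InnerProductSpace.Core ℝ (LieAlg E G)}
    (hB : IsAdInvariant E B) (W : Subrepresentation π.minorRep)
    (hW : ∃ t ∈ W.toSubmodule, π.minorMap t ≠ 0) :
    ∃ r : ℝ, 0 < r ∧ ∀ w : Basis (Fin (finrank ℝ W.toSubmodule)) ℝ W.toSubmodule,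
      π.IsOrthonormalBasis B w → ∀ v, ∑ i, (π.minorMap (w i)).1 v ^ 2 = r * π.discriminant v := by
  obtain ⟨c, hc₁, hc₂⟩ := hπ
  have hc : π.IsSection c := ⟨hc₁, hc₂⟩
  obtain ⟨p, hpc, hp, hpH⟩ := hc.exists_isotropy_eq_fixer
  obtain ⟨S⟩ := π.nonempty_sliceChart p
  have hvol := hc.orbitVolume_pos hp hpc hpH
  let ev : V → π.MinorSpace →ₗ[ℝ] ℝ := fun v => LinearMap.proj v ∘ₗ π.minorFun
  have hev : ∀ v t, ev v t = π.minorFun t v := fun _ _ => rfl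
  obtain ⟨w₀, hw₀⟩ := exists_isOrthonormalBasis (π := π) B W.toSubmodule
  have hpos : 0 < ∑ i, ev p (w₀ i) ^ 2 := by
    refine lt_of_le_of_ne (Finset.sum_nonneg fun i _ => sq_nonneg _) fun h0 => ?_
    obtain ⟨t, ht, htp⟩ := hc.minorFun_ne_zero hp hpc W hW
    have h1 : ∀ i, ev p (w₀ i) = 0 := fun i => by
      have := (Finset.sum_eq_zero_iff_of_nonneg fun i _ => sq_nonneg _).1 h0.symm i
        (Finset.mem_univ i)
      exact pow_eq_zero_iff two_ne_zero |>.1 this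
    have h2 : ev p ∘ₗ W.toSubmodule.subtype = 0 := w₀.ext h1
    exact htp (LinearMap.congr_fun h2 ⟨t, ht⟩)
  refine ⟨(∑ i, ev p (w₀ i) ^ 2) / π.orbitVolume p ^ 2, by positivity, fun w hw v => ?_⟩
  obtain ⟨g, hg⟩ := hc.exists_toHom_mem v
  obtain ⟨w', hw', hw'g⟩ := exists_translate_basis hB W hw g
  have hδ : π.discriminant v = (S.relMap (π.toHom g v)).det ^ 2 * π.orbitVolume p ^ 2 :=
    (π.discriminant_toHom g v).symm.trans (hc.discriminant_eq hp hpc S hpH hg)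
  calc ∑ i, (π.minorMap (w i)).1 v ^ 2
      = ∑ i, ev (π.toHom g v) (w' i) ^ 2 := by
        refine Finset.sum_congr rfl fun i _ => ?_
        rw [hw'g, hev, minorFun_minorRep]
        rfl
    _ = ∑ i, ev (π.toHom g v) (w₀ i) ^ 2 := hw'.sum_sq_eq B hw₀ _
    _ = ∑ i, (S.relMap (π.toHom g v)).det ^ 2 * ev p (w₀ i) ^ 2 := by
        refine Finset.sum_congr rfl fun i _ => ?_
        rw [hev, hev, hc.minorFun_eq hp hpc S hg, mul_pow]
    _ = (S.relMap (π.toHom g v)).det ^ 2 * ∑ i, ev p (w₀ i) ^ 2 := by rw [Finset.mul_sum]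
    _ = (∑ i, ev p (w₀ i) ^ 2) / π.orbitVolume p ^ 2 * π.discriminant v := by
        rw [hδ, div_mul_eq_mul_div, eq_div_iff (pow_pos hvol 2).ne']
        ring

/-- The preceding identity solved for the discriminant. -/
theorem discriminant_eq_sum_sq {ι : Type*} [Fintype ι] {r : ℝ} (hr : 0 < r) (t : ι → π.MinorSpace)
    {v : V} (h : ∑ i, (π.minorMap (t i)).1 v ^ 2 = r * π.discriminant v) :
    π.discriminant v = ∑ i, ((√r)⁻¹ • π.minorMap (t i)).1 v ^ 2 := by
  have h1 : ∀ i, ((√r)⁻¹ • π.minorMap (t i)).1 v ^ 2 = r⁻¹ * (π.minorMap (t i)).1 v ^ 2 := by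
    intro i
    change ((√r)⁻¹ * (π.minorMap (t i)).1 v) ^ 2 = _
    rw [mul_pow, inv_pow, Real.sq_sqrt hr.le]
  simp_rw [h1]
  rw [← Finset.mul_sum, h, inv_mul_cancel_left₀ hr.ne']

/-- An invariant subspace of the image of the minor map lifts isomorphically to the orthogonal
complement of the kernel. -/
theorem exists_lift {B : InnerProductSpace.Core ℝ (LieAlg E G)} (hB : IsAdInvariant E B)
    (U : Subrepresentation (polyRep π.rep π.maxDim))
    (hU : U.toSubmodule ≤ LinearMap.range π.minorMap) :
    ∃ (W : Subrepresentation π.minorRep) (e : W.toSubmodule ≃ₗ[ℝ] U.toSubmodule),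
      ∀ t, (e t : homogPoly V π.maxDim) = π.minorMap t := by
  obtain ⟨K', hK', hcompl⟩ := exists_minorInner_complement (π := π) B (LinearMap.ker π.minorMap)
  let W : Subrepresentation π.minorRep :=
    { toSubmodule := U.toSubmodule.comap π.minorMap ⊓ K'
      apply_mem_toSubmodule := by
        rintro g t ⟨ht, htK⟩
        refine ⟨?_, (hK' _).2 fun k hk => ?_⟩
        · change π.minorMap (π.minorRep g t) ∈ U.toSubmodule
          rw [← polyRep_minorMap]
          exact U.apply_mem_toSubmodule g ht
        · have hk' : π.minorRep g⁻¹ k ∈ LinearMap.ker π.minorMap := by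
            rw [LinearMap.mem_ker] at hk ⊢
            rw [← polyRep_minorMap, hk, map_zero]
          have h1 := (hK' t).1 htK _ hk'
          rw [← minorInner_minorRep B hB g, ← Module.End.mul_apply, ← map_mul, mul_inv_cancel,
            map_one] at h1
          exact h1 }
  let f : W.toSubmodule →ₗ[ℝ] U.toSubmodule :=
    (π.minorMap.restrict (p := W.toSubmodule) (q := U.toSubmodule) fun t ht => ht.1)
  have hinj : Function.Injective f := by
    intro s t hst
    have h1 : π.minorMap s = π.minorMap t := congrArg Subtype.val hst
    exact Subtype.ext (eq_of_map_eq_of_isCompl hcompl s.2.2 t.2.2 h1)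
  have hsurj : Function.Surjective f := by
    rintro ⟨q, hq⟩
    obtain ⟨t, rfl⟩ := hU hq
    obtain ⟨k, hk, k', hk', rfl⟩ := Submodule.mem_sup.1
      (hcompl.sup_eq_top ▸ Submodule.mem_top : t ∈ LinearMap.ker π.minorMap ⊔ K')
    have h1 : π.minorMap (k + k') = π.minorMap k' := by
      rw [map_add, LinearMap.mem_ker.1 hk, zero_add]
    refine ⟨⟨k', ?_, hk'⟩, Subtype.ext h1.symm⟩
    change π.minorMap k' ∈ U.toSubmodule
    rwa [← h1]
  exact ⟨W, LinearEquiv.ofBijective f ⟨hinj, hsurj⟩, fun t => rfl⟩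

end OrthogonalRep

theorem IsIrreducibleSub.exists_ne_zero {G V : Type*} [Group G] [AddCommMonoid V] [Module ℝ V]
    {ρ : Representation ℝ G V} {W : Subrepresentation ρ} (hW : IsIrreducibleSub W) :
    ∃ t : W.toSubmodule, t ≠ 0 := by
  by_contra h
  push Not at h
  have hs : IsSimpleOrder (Subrepresentation W.toRepresentation) := hW
  obtain ⟨a, b, hab⟩ := hs.toNontrivial
  refine hab (Subrepresentation.toSubmodule_injective (Submodule.ext fun x => ?_))
  rw [h x]
  exact ⟨fun _ => zero_mem _, fun _ => zero_mem _⟩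

end PolarDisc

end

theorem mainTheorem2
    {E G V : Type*} [NormedAddCommGroup E] [NormedSpace ℝ E] [FiniteDimensional ℝ E]
    [TopologicalSpace G] [ChartedSpace E G] [Group G] [LieGroup 𝓘(ℝ, E) ∞ G]
    [T2Space G] [CompactSpace G] [ConnectedSpace G]
    [NormedAddCommGroup V] [InnerProductSpace ℝ V] [FiniteDimensional ℝ V]
    [MeasurableSpace V] [BorelSpace V]
    (π : PolarDisc.OrthogonalRep E G V) (hπ : π.IsPolar)
    (B : InnerProductSpace.Core ℝ (PolarDisc.LieAlg E G)) (hB : PolarDisc.IsAdInvariant E B) :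
    (∀ W : Subrepresentation π.minorRep, PolarDisc.IsIrreducibleSub W →
      (∃ t ∈ W.toSubmodule, π.minorMap t ≠ 0) →
      ∃ c : ℝ, 0 < c ∧
        ∀ w : Module.Basis (Fin (Module.finrank ℝ W.toSubmodule)) ℝ W.toSubmodule,
          π.IsOrthonormalBasis B w →
            (∀ v : V, ∑ i, (π.minorMap (w i)).1 v ^ 2 = c * π.discriminant v) ∧
            (∀ v : V, π.discriminant v = ∑ i, ((√c)⁻¹ • π.minorMap (w i)).1 v ^ 2)) ∧
    (∀ U : Subrepresentation (PolarDisc.polyRep π.rep π.maxDim),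
      PolarDisc.IsIrreducibleSub U →
      U.toSubmodule ≤ LinearMap.range π.minorMap →
      ∃ p : Module.Basis (Fin (Module.finrank ℝ U.toSubmodule)) ℝ U.toSubmodule,
        ∀ v : V, π.discriminant v = ∑ i, (p i).1.1 v ^ 2) := by
  have : IsTopologicalGroup G := topologicalGroup_of_lieGroup 𝓘(ℝ, E) ∞
  constructor
  · intro W _ hWne
    obtain ⟨c, hc, h⟩ := hπ.exists_sum_sq_eq hB W hWne
    exact ⟨c, hc, fun w hw => ⟨h w hw, fun v =>
      PolarDisc.OrthogonalRep.discriminant_eq_sum_sq hc (fun i => (w i : π.MinorSpace)) (h w hw v)⟩⟩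
  · intro U hU hUr
    obtain ⟨W, e, he⟩ := PolarDisc.OrthogonalRep.exists_lift hB U hUr
    have hWne : ∃ t ∈ W.toSubmodule, π.minorMap t ≠ 0 := by
      obtain ⟨q, hq⟩ := hU.exists_ne_zero
      refine ⟨e.symm q, (e.symm q).2, fun h0 => hq ?_⟩
      rw [← he, e.apply_symm_apply] at h0
      exact Subtype.ext h0
    obtain ⟨c, hc, h⟩ := hπ.exists_sum_sq_eq hB W hWne
    obtain ⟨w, hw⟩ := PolarDisc.OrthogonalRep.exists_isOrthonormalBasis (π := π) B W.toSubmodule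
    have hc' : (√c)⁻¹ ≠ 0 := inv_ne_zero (Real.sqrt_pos.2 hc).ne'
    refine ⟨((w.map e).unitsSMul fun _ => Units.mk0 (√c)⁻¹ hc').reindex
      (finCongr e.finrank_eq), fun v => ?_⟩
    rw [PolarDisc.OrthogonalRep.discriminant_eq_sum_sq hc (fun i => (w i : π.MinorSpace)) (h w hw v),
      ← Equiv.sum_comp (finCongr e.finrank_eq)]
    refine Finset.sum_congr rfl fun i _ => ?_
    rw [Module.Basis.reindex_apply, Equiv.symm_apply_apply, Module.Basis.unitsSMul_apply,
      Module.Basis.map_apply, ← he]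
    rfl
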